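/- For a set $A$ of non-negative integers write $A(n)=|A\cap[1,n]|$, let $\mathrm d(A)=\lim_{n\to\infty}A(n)/n$ when this limit exists (the asymptotic density of $A$), and let $2A=A+A=\{a+b: a,b\in A\}$. For a nonzero rational number $p/q$ let $v_2(p/q)=v_2(p)-v_2(q)$ be its $2$-adic valuation. (i) (Structure when $\mathrm d(2A)<2\mathrm d(A)$.) Let $A$ be a set of non-negative integers such that $\mathrm d(A)$ and $\mathrm d(2A)$ exist and $\mathrm d(2A)<2\,\mathrm d(A)$. Then there exist positive integers $g$ and $r\le\frac{g+1}{2}$ such that $$\mathrm d(2A)=\frac{2r-1}{g}\qquad\text{and}\qquad \frac{\mathrm d(2A)}{2}<\mathrm d(A)\le\frac{\mathrm d(2A)}{2}+\frac1{2g}.$$ (ii) Let $\beta\in\mathbb Q\cap(0,1)$ satisfy $v_2(\beta)\le 0$. Then $g_0=\min\{g\ge 1: g\beta \text{ is an odd integer}\}$ exists, and for every real $\alpha\in(0,1)$ with $\beta<2\alpha$ the following are equivalent: there exists a set $A$ of positive integers such that $\mathrm d(A)$ and $\mathrm d(2A)$ exist, $\mathrm d(A)=\alpha$ and $\mathrm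 d(2A)=\beta$; and $$\frac{\beta}{2}<\alpha\le\frac{\beta}{2}+\frac{1}{2g_0}.$$ -/

import Mathlib

open Filter Topology
open scoped Pointwise

/-- The counting function `A(n) = |A ∩ [1, n]|` of a set of natural numbers. -/
noncomputable def countUpTo (A : Set ℕ) (n : ℕ) : ℕ := (A ∩ Set.Icc 1 n).ncard

/-- The asymptotic density of `A` exists and is equal to `d`: `A(n) / n → d` as `n → ∞`. -/
def HasDensity (A : Set ℕ) (d : ℝ) : Prop :=
  Tendsto (fun n : ℕ => (countUpTo A n : ℝ) / (n : ℝ)) atTop (𝓝 d)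

/-! Structure. Translate two copies of `A` by elements `a`, `a'` of `A` and apply the Dyson
transform with every possible `e`. The result is a set `D` inside `2A - (a + a')`, containing 0,
with sets `T l` of shifts preserving `D` below `l`. No element is lost in the count, so `d(2A) < 2
d(A)` forces `T l` to have at least `l / m` elements, with `m` depending only on `2 d(A) - d(2A)`.
The counting function of `D` is superadditive along these shifts; at scales where it is close to its
lower density the superadditivity is nearly an equality, and the central shifts become
almost-periods. By pigeonhole all multiples of `L = (8m)!` are then almost-periods, so almost all
multiples of `L` lie in `D` (`tendsto_card_missing`).

Hence, up to density zero, `2A` is the union of the classes modulo `L` that it meets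
(`exists_residues`). What remains concerns a set `S` in `ZMod L` with `|2S| < 2|S|`. Kneser's
theorem, proved by the same transform in a finite group together with a lemma on unions of periodic
sets, shows that modulo the periods of `2S` the set `S` has `r` elements and `2S` has `2r - 1`.

Realization. Part one makes `gβ = 2r - 1` odd, so `g ≥ g₀`, which gives necessity. Conversely, with
`q = g₀` and `r` defined by `qβ = 2r - 1`, take all of the classes `0, ..., r - 2` modulo `q` and a
proportion `θ > 1/2` of the class `r - 1`. The sumset then fills the classes `0, ..., 2r - 2` from
some point on. -/

/-! ### The Dyson transform for sets of natural numbers. -/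

/-- One step of the Dyson process: if `e ∈ A`, add `e + B` to `A` and keep in `B` only those
elements whose translate by `e` was already in `A`. -/
def dysonStep (e : ℕ) (p : Set ℕ × Set ℕ) : Set ℕ × Set ℕ :=
  (p.1 ∪ {x | e ∈ p.1 ∧ ∃ b ∈ p.2, e + b = x}, {b | b ∈ p.2 ∧ (e ∈ p.1 → e + b ∈ p.1)})

/-- The Dyson process, which applies `dysonStep` with `e = 0, 1, 2, …` in turn. -/
def dysonSeq (A B : Set ℕ) : ℕ → Set ℕ × Set ℕ
  | 0 => (A, B)
  | e + 1 => dysonStep e (dysonSeq A B e)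

lemma dysonSeq_fst_mono (A B : Set ℕ) : Monotone fun e => (dysonSeq A B e).1 :=
  monotone_nat_of_le_succ fun _ => Set.subset_union_left

lemma dysonSeq_snd_anti (A B : Set ℕ) : Antitone fun e => (dysonSeq A B e).2 :=
  antitone_nat_of_succ_le fun _ _ hb => hb.1

lemma dysonSeq_zero_mem {A B : Set ℕ} (hB : 0 ∈ B) (e : ℕ) : 0 ∈ (dysonSeq A B e).2 := by
  induction e with
  | zero => exact hB
  | succ e ih => exact ⟨ih, fun h => by simpa using h⟩

lemma dysonSeq_add_mem {A B C : Set ℕ} (h : ∀ a ∈ A, ∀ b ∈ B, a + b ∈ C) (e : ℕ) :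
    ∀ a ∈ (dysonSeq A B e).1, ∀ b ∈ (dysonSeq A B e).2, a + b ∈ C := by
  induction e with
  | zero => exact h
  | succ e ih =>
    rintro a (ha | ⟨he, b', hb', rfl⟩) b ⟨hb, hb2⟩
    · exact ih a ha b hb
    · rw [add_right_comm]
      exact ih _ (hb2 he) _ hb'

/-- An element of the limit set belongs to the stage with its own index. -/
lemma dysonSeq_fst_stable {A B : Set ℕ} {a e : ℕ} (ha : a ∈ (dysonSeq A B e).1) :
    a ∈ (dysonSeq A B a).1 := by
  induction e with
  | zero => exact dysonSeq_fst_mono A B (Nat.zero_le a) ha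
  | succ e ih =>
    by_cases h : a ∈ (dysonSeq A B e).1
    · exact ih h
    · rcases ha with ha | ⟨he, b, hb, rfl⟩
      · exact absurd ha h
      -- Step `e` only adds numbers `e + b`. For `b > 0` such a number enters no later than the
      -- stage with its own index, and `b = 0` adds nothing new.
      · rcases Nat.eq_zero_or_pos b with rfl | hb0
        · exact absurd (by simpa using he) h
        · exact dysonSeq_fst_mono A B (show e + 1 ≤ e + b by omega) (Or.inr ⟨he, b, hb, rfl⟩)

/-- Since `a < t`, the shift `b` has survived the step with index `a`, and at that step `a` was
already present. -/
lemma dysonSeq_closed {A B : Set ℕ} {a b t e : ℕ} (ha : a ∈ (dysonSeq A B e).1) (hat : a < t)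
    (hb : b ∈ (dysonSeq A B t).2) : a + b ∈ (dysonSeq A B a).1 :=
  (dysonSeq_snd_anti A B (show a + 1 ≤ t from hat) hb).2 (dysonSeq_fst_stable ha)

open Classical in
/-- The elements of `S` below `l`. -/
noncomputable def below (S : Set ℕ) (l : ℕ) : Finset ℕ := {x ∈ Finset.range l | x ∈ S}

@[simp] lemma mem_below {S : Set ℕ} {l x : ℕ} : x ∈ below S l ↔ x < l ∧ x ∈ S := by
  simp [below]

/-- The Dyson process turns a pair `A, B` with `A + B ⊆ C` into a set `D ⊆ C` together with sets
`T l` of almost-periods of `D`, without loss in the counting functions. -/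
theorem exists_dyson_closure {A B C : Set ℕ} (hA : 0 ∈ A) (hB : 0 ∈ B)
    (hC : ∀ a ∈ A, ∀ b ∈ B, a + b ∈ C) :
    ∃ (D : Set ℕ) (T : ℕ → Finset ℕ), 0 ∈ D ∧ D ⊆ C ∧ (∀ l, ∀ b ∈ T l, 0 < b ∧ b < l) ∧
      (∀ l, ∀ b ∈ T l, ∀ a ∈ D, a + b < l → a + b ∈ D) ∧
      ∀ l, (below A l).card + (below B l).card ≤ (below D l).card + (T l).card + 1 := by
  classical
  set P := dysonSeq A B with hP
  let D : Set ℕ := {x | ∃ e, x ∈ (P e).1}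
  -- `a + b < l` means `a < l - b`, so `b` needs to survive only the steps with index below `l - b`
  -- to preserve `D` below `l`.
  let T : ℕ → Finset ℕ := fun l => {b ∈ Finset.range l | 0 < b ∧ b ∈ (P (l - b)).2}
  have hAD : A ⊆ D := fun a ha => ⟨0, ha⟩
  refine ⟨D, T, hAD hA, ?_, ?_, ?_, ?_⟩
  · rintro x ⟨e, hx⟩
    simpa using dysonSeq_add_mem hC e x hx 0 (dysonSeq_zero_mem hB e)
  · intro l b hb
    simp only [T, Finset.mem_filter, Finset.mem_range] at hb
    exact ⟨hb.2.1, hb.1⟩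
  · rintro l b hb a ⟨e, ha⟩ hab
    simp only [T, Finset.mem_filter, Finset.mem_range] at hb
    exact ⟨a, dysonSeq_closed ha (show a < l - b by omega) hb.2.2⟩
  · intro l
    -- A nonzero `b < l` of `B` outside `T l` was rejected at some step `e < l - b`, and that step
    -- put the new element `e + b < l` into `D`. The `+ 1` in the bound pays for `b = 0`.
    have hrem : ∀ b ∈ B, ∀ t, b ∉ (P t).2 → ∃ e < t, e ∈ (P e).1 ∧ b ∈ (P e).2 ∧
        e + b ∉ (P e).1 := by
      intro b hb t
      induction t with
      | zero => exact fun h => absurd hb h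
      | succ t ih =>
        intro h
        by_cases h' : b ∈ (P t).2
        · have : ¬ (b ∈ (P t).2 ∧ (t ∈ (P t).1 → t + b ∈ (P t).1)) := h
          push Not at this
          obtain ⟨h1, h2⟩ := this h'
          exact ⟨t, Nat.lt_succ_self t, h1, h', h2⟩
        · obtain ⟨e, he, h⟩ := ih h'
          exact ⟨e, by omega, h⟩
    have hex : ∀ b, ∃ e, b ∈ below B l \ (T l ∪ {0}) → e + b < l ∧ e ∈ (P e).1 ∧ b ∈ (P e).2 ∧
        e + b ∉ (P e).1 := by
      intro b
      by_cases hb : b ∈ below B l \ (T l ∪ {0})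
      · have hb' := hb
        simp only [T, Finset.mem_sdiff, mem_below, Finset.mem_union, Finset.mem_filter,
          Finset.mem_range, Finset.mem_singleton, not_or, not_and] at hb'
        obtain ⟨⟨h1, h2⟩, h3, h4⟩ := hb'
        obtain ⟨e, he, h⟩ := hrem b h2 (l - b) (h3 h1 (Nat.pos_of_ne_zero h4))
        exact ⟨e, fun _ => ⟨by omega, h⟩⟩
      · exact ⟨0, fun h => absurd h hb⟩
    choose e he using hex
    have hnew : ∀ b ∈ below B l \ (T l ∪ {0}), e b + b ∈ (P (e b + 1)).1 := fun b hb =>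
      Or.inr ⟨(he b hb).2.1, b, (he b hb).2.2.1, rfl⟩
    -- `e b + b` enters precisely at step `e b`, so equal values come from the same step and hence
    -- from the same `b`.
    have hinj : Set.InjOn (fun b => e b + b) (below B l \ (T l ∪ {0}) : Finset ℕ) := by
      intro b hb b' hb' hbb
      simp only at hbb
      rcases lt_trichotomy (e b) (e b') with h | h | h
      · refine absurd (dysonSeq_fst_mono A B (show e b + 1 ≤ e b' from h) (hnew b hb)) ?_
        show e b + b ∉ _
        rw [hbb]; exact (he b' hb').2.2.2
      · omega
      · refine absurd (dysonSeq_fst_mono A B (show e b' + 1 ≤ e b from h) (hnew b' hb')) ?_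
        show e b' + b' ∉ _
        rw [← hbb]; exact (he b hb).2.2.2
    have hsub : below A l ∪ (below B l \ (T l ∪ {0})).image (fun b => e b + b) ⊆ below D l := by
      intro x hx
      rcases Finset.mem_union.1 hx with hx | hx
      · rw [mem_below] at hx ⊢
        exact ⟨hx.1, hAD hx.2⟩
      · obtain ⟨b, hb, rfl⟩ := Finset.mem_image.1 hx
        exact mem_below.2 ⟨(he b hb).1, _, hnew b hb⟩
    have hdisj : Disjoint (below A l) ((below B l \ (T l ∪ {0})).image (fun b => e b + b)) := by
      rw [Finset.disjoint_left]
      intro x hx hx'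
      obtain ⟨b, hb, rfl⟩ := Finset.mem_image.1 hx'
      exact (he b hb).2.2.2 (dysonSeq_fst_mono A B (Nat.zero_le _) (mem_below.1 hx).2)
    have h1 := Finset.card_le_card hsub
    rw [Finset.card_union_of_disjoint hdisj, Finset.card_image_of_injOn hinj] at h1
    have h2 := Finset.le_card_sdiff (T l ∪ {0}) (below B l)
    have h3 := Finset.card_union_le (T l) {0}
    rw [Finset.card_singleton] at h3
    omega

/-! ### Superadditivity and scales with few shift defects. -/

open Classical in
/-- The `z < l - b` that lie outside `D` although `z + b` lies in `D`. -/
noncomputable def shiftDefect (D : Set ℕ) (l b : ℕ) : Finset ℕ :=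
  {z ∈ Finset.range (l - b) | z ∉ D ∧ z + b ∈ D}

lemma mem_shiftDefect {D : Set ℕ} {l b z : ℕ} :
    z ∈ shiftDefect D l b ↔ z < l - b ∧ z ∉ D ∧ z + b ∈ D := by
  simp [shiftDefect]

lemma card_below_le (D : Set ℕ) (l : ℕ) : (below D l).card ≤ l := by
  classical
  simpa [below] using Finset.card_filter_le (Finset.range l) (· ∈ D)

/-- On `[b, l)` the set `D` contains both the shift of `D` below `l - b` and the shift of the
defect, which are disjoint: the defect measures the slack in superadditivity. -/
lemma card_below_superadd {D : Set ℕ} {l b : ℕ} (hbl : b < l)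
    (h : ∀ a ∈ D, a + b < l → a + b ∈ D) :
    (shiftDefect D l b).card + (below D b).card + (below D (l - b)).card ≤ (below D l).card := by
  classical
  have hsub : below D b ∪ (shiftDefect D l b ∪ below D (l - b)).image (· + b) ⊆ below D l := by
    intro x hx
    simp only [Finset.mem_union, Finset.mem_image, mem_below, mem_shiftDefect] at hx ⊢
    rcases hx with hx | ⟨z, hz | hz, rfl⟩
    · exact ⟨by omega, hx.2⟩
    · exact ⟨by omega, hz.2.2⟩
    · exact ⟨by omega, h z hz.2 (by omega)⟩
  have hd1 : Disjoint (shiftDefect D l b) (below D (l - b)) := by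
    rw [Finset.disjoint_left]
    intro z hz hz'
    exact (mem_shiftDefect.1 hz).2.1 (mem_below.1 hz').2
  have hd2 : Disjoint (below D b)
      ((shiftDefect D l b ∪ below D (l - b)).image (· + b)) := by
    rw [Finset.disjoint_left]
    intro z hz hz'
    obtain ⟨w, -, rfl⟩ := Finset.mem_image.1 hz'
    have := (mem_below.1 hz).1
    omega
  have := Finset.card_le_card hsub
  rw [Finset.card_union_of_disjoint hd2,
    Finset.card_image_of_injective _ (add_left_injective b),
    Finset.card_union_of_disjoint hd1] at this
  omega

/-- Near almost every scale there is one at which all central elements of `T` are almost-periods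
of `D`. -/
theorem exists_scale_shiftDefect_le {D : Set ℕ} {T : ℕ → Finset ℕ} {m l₀ : ℕ} (hm : 0 < m)
    (hT : ∀ l, ∀ b ∈ T l, 0 < b ∧ b < l)
    (hcl : ∀ l, ∀ b ∈ T l, ∀ a ∈ D, a + b < l → a + b ∈ D)
    (hcard : ∀ l ≥ l₀, l ≤ m * (T l).card) {ν : ℝ} (hν : 0 < ν) :
    ∃ Y₀, ∀ Y ≥ Y₀, ∃ l, Y ≤ l ∧ l ≤ 2 * m * Y ∧ ∀ b ∈ T l, l ≤ 4 * m * b →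
      l ≤ 4 * m * (l - b) → ((shiftDefect D l b).card : ℝ) ≤ ν * l := by
  set f : ℕ → ℕ := fun l => (below D l).card with hf
  -- The supremum of `Θ` is the lower density of `D`.
  set Θ : Set ℝ := {θ | ∃ Y, ∀ l ≥ Y, θ * l ≤ f l} with hΘ
  have hbdd : BddAbove Θ := by
    refine ⟨1, ?_⟩
    rintro θ ⟨Y, hY⟩
    have h1 := hY (Y + 1) (by omega)
    have h2 : (f (Y + 1) : ℝ) ≤ (Y + 1 : ℕ) := by exact_mod_cast card_below_le D (Y + 1)
    have h3 : (0 : ℝ) < (Y + 1 : ℕ) := by positivity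
    by_contra! h
    nlinarith
  have hne : Θ.Nonempty := ⟨0, 0, fun l _ => by simp⟩
  obtain ⟨θ, ⟨Y₁, hY₁⟩, hθ⟩ := exists_lt_of_lt_csSup hne (show sSup Θ - ν / 2 < sSup Θ by linarith)
  -- If the ratio `f l / l` were at least `sSup Θ + ν / 2` on the whole window `[Y, 2mY]`,
  -- superadditivity would propagate this to all larger `l`, against the choice of the supremum.
  have hscale : ∀ Y, 1 ≤ Y → l₀ ≤ Y → ∃ l, Y ≤ l ∧ l ≤ 2 * m * Y ∧
      (f l : ℝ) < (sSup Θ + ν / 2) * l := by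
    intro Y hY1 hYl
    by_contra! hcon
    have hall : ∀ l, Y ≤ l → (sSup Θ + ν / 2) * l ≤ f l := by
      intro l
      induction l using Nat.strong_induction_on with
      | _ l ih =>
        intro hl
        rcases le_or_gt l (2 * m * Y) with hlZ | hlZ
        · exact hcon l hl hlZ
        · have hcl' := hcard l (hYl.trans hl)
          have hbig : 2 * Y < (T l).card := by
            by_contra! h
            have := Nat.mul_le_mul_left m h
            nlinarith
          -- `T l` has more than `2Y` elements, so one of them is at distance at least `Y` from both
          -- ends.
          obtain ⟨b, hb, hb1, hb2⟩ : ∃ b ∈ T l, Y ≤ b ∧ Y ≤ l - b := by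
            by_contra! h
            have hsub : T l ⊆ Finset.range Y ∪ Finset.Ico (l - Y) l := by
              intro b hb
              have h1 := (hT l b hb).2
              have h2 := h b hb
              simp only [Finset.mem_union, Finset.mem_range, Finset.mem_Ico]
              by_cases h3 : Y ≤ b
              · have := h2 h3; omega
              · omega
            have := (Finset.card_le_card hsub).trans (Finset.card_union_le _ _)
            simp only [Finset.card_range, Nat.card_Ico] at this
            omega
          have hb0 := hT l b hb
          have i1 := ih b hb0.2 hb1
          have i2 := ih (l - b) (by omega) hb2
          have i3 := card_below_superadd hb0.2 (hcl l b hb)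
          have i4 : (f b : ℝ) + f (l - b) ≤ f l := by
            exact_mod_cast (by simp only [hf]; omega : f b + f (l - b) ≤ f l)
          have i5 : ((l - b : ℕ) : ℝ) = l - b := by
            rw [Nat.cast_sub hb0.2.le]
          rw [i5] at i2
          nlinarith
    have := le_csSup hbdd (show sSup Θ + ν / 2 ∈ Θ from ⟨Y, hall⟩)
    linarith
  refine ⟨max (max 1 l₀) (4 * m * Y₁), fun Y hY => ?_⟩
  simp only [ge_iff_le, max_le_iff] at hY
  obtain ⟨l, hl1, hl2, hl3⟩ := hscale Y hY.1.1 hY.1.2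
  refine ⟨l, hl1, hl2, fun b hb hb1 hb2 => ?_⟩
  have hb0 := hT l b hb
  have j1 : Y₁ ≤ b := by
    by_contra! h
    have : 4 * m * b < 4 * m * Y₁ := Nat.mul_lt_mul_of_pos_left h (by omega)
    omega
  have j2 : Y₁ ≤ l - b := by
    by_contra! h
    have : 4 * m * (l - b) < 4 * m * Y₁ := Nat.mul_lt_mul_of_pos_left h (by omega)
    omega
  -- The two pieces have ratio at least `sSup Θ - ν / 2` and the whole has ratio below `sSup Θ + ν /
  -- 2`, which leaves at most `ν * l` for the defect.
  have i1 := hY₁ b j1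
  have i2 := hY₁ (l - b) j2
  have i3 : ((shiftDefect D l b).card : ℝ) + f b + f (l - b) ≤ f l := by
    exact_mod_cast card_below_superadd hb0.2 (hcl l b hb)
  rw [Nat.cast_sub hb0.2.le] at i2
  have i4 : (sSup Θ - ν / 2) * l ≤ θ * l := by gcongr
  nlinarith

/-! ### Almost-periods and the multiples of a fixed modulus. -/

open Classical in
/-- The `z` with `z, z + p < M` on which the indicator function of `D` differs at `z` and
`z + p`. -/
noncomputable def periodDefect (D : Set ℕ) (M p : ℕ) : Finset ℕ :=
  {z ∈ Finset.range M | z + p < M ∧ ¬ (z ∈ D ↔ z + p ∈ D)}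

lemma mem_periodDefect {D : Set ℕ} {M p z : ℕ} :
    z ∈ periodDefect D M p ↔ z + p < M ∧ ¬ (z ∈ D ↔ z + p ∈ D) := by
  simp only [periodDefect, Finset.mem_filter, Finset.mem_range, and_iff_right_iff_imp]
  intro h; omega

/-- Membership at `z` and at `z + p` are both compared with membership at `z + b = (z + p) + b'`. -/
lemma card_periodDefect_sub_le {D : Set ℕ} {l M b b' p E : ℕ} (hp : b = b' + p)
    (hM : M ≤ l - b) (hb : ∀ a ∈ D, a + b < l → a + b ∈ D) (hb' : ∀ a ∈ D, a + b' < l → a + b' ∈ D)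
    (hE : (shiftDefect D l b).card ≤ E) (hE' : (shiftDefect D l b').card ≤ E) :
    (periodDefect D M p).card ≤ 2 * E := by
  classical
  have hsub : periodDefect D M p ⊆
      shiftDefect D l b ∪ {z ∈ periodDefect D M p | z + p ∈ shiftDefect D l b'} := by
    intro z hz
    have hz' := mem_periodDefect.1 hz
    simp only [Finset.mem_union, Finset.mem_filter, mem_shiftDefect]
    by_cases h : z ∈ D
    · have h2 : z + p ∉ D := fun h2 => hz'.2 ⟨fun _ => h2, fun _ => h⟩
      refine Or.inr ⟨hz, by omega, h2, ?_⟩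
      have := hb z h (by omega)
      rwa [hp, add_comm b', ← add_assoc] at this
    · have h2 : z + p ∈ D := by
        by_contra h2
        exact hz'.2 ⟨fun h' => absurd h' h, fun h' => absurd h' h2⟩
      refine Or.inl ⟨by omega, h, ?_⟩
      have := hb' _ h2 (by omega)
      rwa [hp, add_comm b', ← add_assoc]
  have h2 : ({z ∈ periodDefect D M p | z + p ∈ shiftDefect D l b'} : Finset ℕ).card
      ≤ (shiftDefect D l b').card :=
    Finset.card_le_card_of_injOn (· + p) (fun z hz => (Finset.mem_filter.1 hz).2)
      (add_left_injective p).injOn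
  have := (Finset.card_le_card hsub).trans (Finset.card_union_le _ _)
  omega

lemma card_periodDefect_mul_le (D : Set ℕ) (M p r : ℕ) :
    (periodDefect D M (r * p)).card ≤ r * (periodDefect D M p).card := by
  classical
  induction r with
  | zero =>
    simp only [Nat.zero_mul, nonpos_iff_eq_zero, Finset.card_eq_zero]
    ext z; simp [mem_periodDefect]
  | succ r ih =>
    have hsub : periodDefect D M ((r + 1) * p) ⊆ periodDefect D M (r * p) ∪
        {z ∈ periodDefect D M ((r + 1) * p) | z + r * p ∈ periodDefect D M p} := by
      intro z hz
      have hz' := mem_periodDefect.1 hz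
      have he : z + (r + 1) * p = z + r * p + p := by ring
      simp only [Finset.mem_union, Finset.mem_filter, hz, true_and]
      rw [mem_periodDefect, mem_periodDefect]
      rw [he] at hz'
      by_contra! h
      have h1 := h.1 (by omega)
      have h2 := h.2 (by omega)
      exact hz'.2 (h1.trans h2)
    have h2 : ({z ∈ periodDefect D M ((r + 1) * p) | z + r * p ∈ periodDefect D M p} :
        Finset ℕ).card ≤ (periodDefect D M p).card :=
      Finset.card_le_card_of_injOn (· + r * p) (fun z hz => (Finset.mem_filter.1 hz).2)
        (add_left_injective _).injOn
    have := (Finset.card_le_card hsub).trans (Finset.card_union_le _ _)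
    rw [Nat.succ_mul r (periodDefect D M p).card]
    omega

/-- Some multiple `j * s`, `1 ≤ j ≤ 8 * m`, is a difference of a set of positive density. -/
lemma exists_mul_eq_sub {T : Finset ℕ} {l m s : ℕ} (hl : 0 < l) (hT : ∀ b ∈ T, b < l)
    (hcard : l ≤ 4 * m * T.card) (hs : 8 * m * s ≤ l) :
    ∃ j, 0 < j ∧ j ≤ 8 * m ∧ ∃ b ∈ T, ∃ b' ∈ T, b = b' + j * s := by
  have hpos : 0 < T.card := by
    rcases Nat.eq_zero_or_pos T.card with h | h
    · rw [h] at hcard; omega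
    · exact h
  -- The values `b + i * s` with `i ≤ 8 * m` all lie below `2 * l`, and there are more than `2 * l`
  -- pairs `(i, b)`.
  have hlt : (Finset.range (2 * l)).card < (Finset.range (8 * m + 1) ×ˢ T).card := by
    rw [Finset.card_product, Finset.card_range, Finset.card_range]
    nlinarith
  have hmaps : Set.MapsTo (fun x : ℕ × ℕ => x.2 + x.1 * s)
      (Finset.range (8 * m + 1) ×ˢ T : Finset (ℕ × ℕ)) (Finset.range (2 * l) : Finset ℕ) := by
    rintro ⟨i, b⟩ hx
    simp only [Finset.coe_product, Set.mem_prod, Finset.mem_coe, Finset.mem_range] at hx ⊢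
    have h1 := hT b hx.2
    have h2 : i * s ≤ 8 * m * s := Nat.mul_le_mul_right s (by omega)
    omega
  obtain ⟨⟨i, b⟩, hx, ⟨i', b'⟩, hx', hne, heq⟩ :=
    Finset.exists_ne_map_eq_of_card_lt_of_maps_to hlt hmaps
  simp only [Finset.mem_product, Finset.mem_range] at hx hx' heq
  rcases lt_trichotomy i i' with h | h | h
  · obtain ⟨d, rfl⟩ := Nat.exists_eq_add_of_lt h
    refine ⟨d + 1, by omega, by omega, b, hx.2, b', hx'.2, ?_⟩
    nlinarith
  · subst h
    exact absurd (by simpa using heq) (fun h => hne (by rw [h]))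
  · obtain ⟨d, rfl⟩ := Nat.exists_eq_add_of_lt h
    refine ⟨d + 1, by omega, by omega, b', hx'.2, b, hx.2, ?_⟩
    nlinarith

/-- Sort the pairs by their difference `L * s`: there are at most `M` values of `s`, and each fibre
embeds in one period defect. -/
lemma card_le_of_periodDefect {D : Set ℕ} {M L K : ℕ} (hL : 0 < L)
    (hK : ∀ s, L * s < M → (periodDefect D M (L * s)).card ≤ K) (P : Finset (ℕ × ℕ))
    (hP : ∀ x ∈ P, x.1 ≤ x.2 ∧ x.2 < M ∧ L ∣ x.2 - x.1 ∧ ¬ (x.1 ∈ D ↔ x.2 ∈ D)) :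
    P.card ≤ M * K := by
  classical
  have hmaps : ∀ x ∈ P, (x.2 - x.1) / L ∈ Finset.range M := by
    intro x hx
    obtain ⟨h1, h2, h3, h4⟩ := hP x hx
    exact Finset.mem_range.2 ((Nat.div_le_self _ _).trans_lt (by omega))
  rw [Finset.card_eq_sum_card_fiberwise hmaps]
  refine (Finset.sum_le_card_nsmul _ _ K fun s _ => ?_).trans (by simp)
  rcases Finset.eq_empty_or_nonempty {x ∈ P | (x.2 - x.1) / L = s} with h | ⟨x, hx⟩
  · rw [h]; simp
  · have key : ∀ x ∈ ({x ∈ P | (x.2 - x.1) / L = s} : Finset (ℕ × ℕ)), x.2 = x.1 + L * s := by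
      intro x hx
      obtain ⟨hx, hs⟩ := Finset.mem_filter.1 hx
      obtain ⟨h1, h2, ⟨t, ht⟩, h4⟩ := hP x hx
      rw [ht, Nat.mul_div_cancel_left _ hL] at hs
      subst hs
      omega
    have hsM : L * s < M := by
      have h1 := key x hx
      have h2 := (hP x (Finset.mem_filter.1 hx).1).2.1
      omega
    refine le_trans ?_ (hK s hsM)
    refine Finset.card_le_card_of_injOn Prod.fst (fun y hy => ?_) fun y hy z hz hyz => ?_
    · have h1 := key y hy
      obtain ⟨-, h2, -, h4⟩ := hP y (Finset.mem_filter.1 hy).1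
      exact mem_periodDefect.2 ⟨h1 ▸ h2, h1 ▸ h4⟩
    · exact Prod.ext hyz (by rw [key y hy, key z hz, hyz])

open Classical in
/-- The multiples of `L` below `M` that do not belong to `D`. -/
noncomputable def missing (D : Set ℕ) (L M : ℕ) : Finset ℕ :=
  {y ∈ Finset.range M | L ∣ y ∧ y ∉ D}

lemma mem_missing {D : Set ℕ} {L M y : ℕ} : y ∈ missing D L M ↔ y < M ∧ L ∣ y ∧ y ∉ D := by
  simp [missing]

/-- For every `s` some `j * s` with `j ≤ 8 * m` is a difference of elements of `T`, hence an
almost-period; as `j` divides `(8 * m)!`, so is `L * s`. Each multiple of `L` in `D` forms a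
discordant pair with each missing one, so there cannot be many of both kinds. -/
theorem card_missing_mul_le {D : Set ℕ} {T : Finset ℕ} {l m E : ℕ} (hm : 0 < m) (h0 : 0 ∈ D)
    (hl : 4 * m ≤ l) (hT : ∀ b ∈ T, b < l) (hT' : ∀ b ∈ T, l ≤ 4 * m * (l - b))
    (hcl : ∀ b ∈ T, ∀ a ∈ D, a + b < l → a + b ∈ D)
    (hE : ∀ b ∈ T, (shiftDefect D l b).card ≤ E) (hcard : l ≤ 4 * m * T.card) :
    (missing D (8 * m).factorial (l / (4 * m))).card * (T.card / (8 * m * (8 * m).factorial)) ≤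
      (missing D (8 * m).factorial (l / (4 * m))).card * E +
        2 * (l / (4 * m) * ((8 * m).factorial * (2 * E))) := by
  classical
  set L := (8 * m).factorial with hLdef
  set M := l / (4 * m) with hM
  have hL : 0 < L := Nat.factorial_pos _
  have hM0 : 0 < M := Nat.div_pos hl (by omega)
  have hMl : M * (4 * m) ≤ l := Nat.div_mul_le_self _ _
  have hMb : ∀ b ∈ T, M ≤ l - b := by
    intro b hb
    have := hT' b hb
    refine le_of_mul_le_mul_left (?_ : 4 * m * M ≤ 4 * m * (l - b)) (by omega)
    linarith
  have hK : ∀ s, L * s < M → (periodDefect D M (L * s)).card ≤ L * (2 * E) := by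
    intro s hs
    have hs' : 8 * m * s ≤ l := by
      have h1 : 8 * m * s ≤ L * s := Nat.mul_le_mul_right s (Nat.self_le_factorial _)
      have h2 : M ≤ l := Nat.div_le_self _ _
      omega
    obtain ⟨j, hj, hjm, b, hb, b', hb', hbb⟩ := exists_mul_eq_sub (by omega) hT hcard hs'
    obtain ⟨r, hr⟩ : j ∣ L := Nat.dvd_factorial hj hjm
    have h1 := card_periodDefect_sub_le hbb (hMb b hb) (hcl b hb) (hcl b' hb') (hE b hb) (hE b' hb')
    have h2 := card_periodDefect_mul_le D M (j * s) r
    have h3 : L * s = r * (j * s) := by rw [hr]; ring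
    rw [h3]
    refine h2.trans (Nat.mul_le_mul ?_ h1)
    rw [hr]; exact Nat.le_mul_of_pos_left r hj
  set n := T.card / (8 * m * L) with hn
  set U := missing D L M with hU
  -- Since `0 ∈ D`, the set `T` lies in `D`. Some cell of fixed `b / M` and `b % L` holds `n`
  -- elements of `T`; subtracting the least one, `b'`, yields multiples of `L` below `M`, in `D`
  -- except for at most `E` defects of `b'`.
  obtain ⟨Z, hZ, hZn⟩ : ∃ Z : Finset ℕ, (∀ z ∈ Z, z < M ∧ L ∣ z ∧ z ∈ D) ∧ n ≤ Z.card + E := by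
    have hdivM : ∀ b ∈ T, (b / M, b % L) ∈ Finset.range (8 * m) ×ˢ Finset.range L := by
      intro b hb
      simp only [Finset.mem_product, Finset.mem_range]
      refine ⟨(Nat.div_lt_iff_lt_mul hM0).2 ?_, Nat.mod_lt _ hL⟩
      have h1 : l < (M + 1) * (4 * m) := Nat.lt_mul_of_div_lt (Nat.lt_succ_self _) (by omega)
      have h2 := hT b hb
      nlinarith
    have hcells : (Finset.range (8 * m) ×ˢ Finset.range L).card * n ≤ T.card := by
      rw [Finset.card_product, Finset.card_range, Finset.card_range]
      exact Nat.mul_div_le _ _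
    obtain ⟨⟨u, v⟩, -, huv⟩ := Finset.exists_le_card_fiber_of_mul_le_card_of_maps_to hdivM
      ⟨(0, 0), by simp [hL, hm]⟩ hcells
    set W := ({b ∈ T | (b / M, b % L) = (u, v)} : Finset ℕ) with hW
    rcases W.eq_empty_or_nonempty with hWe | hWne
    · refine ⟨∅, by simp, ?_⟩
      rw [hWe] at huv
      simp only [Finset.card_empty] at huv ⊢
      omega
    · obtain ⟨b', hb'W, hmin⟩ := W.exists_min_image id hWne
      have hb' := Finset.mem_filter.1 hb'W
      refine ⟨{z ∈ Finset.range M | L ∣ z ∧ z ∈ D}, by simp, huv.trans ?_⟩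
      have hsub : W ⊆ (({z ∈ Finset.range M | L ∣ z ∧ z ∈ D} : Finset ℕ) ∪
          shiftDefect D l b').image (· + b') := by
        intro b hbW
        have hb := Finset.mem_filter.1 hbW
        have hle : b' ≤ b := hmin b hbW
        have e1 : b / M = b' / M := (Prod.mk.inj hb.2).1.trans (Prod.mk.inj hb'.2).1.symm
        have e2 : b' % L = b % L := (Prod.mk.inj hb'.2).2.trans (Prod.mk.inj hb.2).2.symm
        have hlt : b - b' < M := by
          have h1 := Nat.div_add_mod b M
          have h2 := Nat.div_add_mod b' M
          have h3 := Nat.mod_lt b hM0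
          rw [e1] at h1
          omega
        have hdvd : L ∣ b - b' := (Nat.modEq_iff_dvd' hle).1 e2
        have hbD : b ∈ D := by
          simpa using hcl b hb.1 0 h0 (by simpa using hT b hb.1)
        have hbl := hT b hb.1
        refine Finset.mem_image.2 ⟨b - b', ?_, Nat.sub_add_cancel hle⟩
        by_cases h : b - b' ∈ D
        · exact Finset.mem_union_left _ (by simp [hlt, hdvd, h])
        · refine Finset.mem_union_right _ (mem_shiftDefect.2 ⟨by omega, h, ?_⟩)
          rwa [Nat.sub_add_cancel hle]
      have h1 := (Finset.card_le_card hsub).trans Finset.card_image_le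
      have h2 := h1.trans (Finset.card_union_le _ _)
      have h3 := hE b' hb'.1
      omega
  have hpairs : Z.card * U.card ≤ 2 * (M * (L * (2 * E))) := by
    have hsub : Z ×ˢ U ⊆ {x ∈ Z ×ˢ U | x.1 ≤ x.2} ∪ {x ∈ Z ×ˢ U | x.2 ≤ x.1} := by
      intro x hx
      rcases le_total x.1 x.2 with h | h
      · exact Finset.mem_union_left _ (Finset.mem_filter.2 ⟨hx, h⟩)
      · exact Finset.mem_union_right _ (Finset.mem_filter.2 ⟨hx, h⟩)
    have h1 : ({x ∈ Z ×ˢ U | x.1 ≤ x.2} : Finset (ℕ × ℕ)).card ≤ M * (L * (2 * E)) := by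
      refine card_le_of_periodDefect hL hK _ fun x hx => ?_
      obtain ⟨hx, hle⟩ := Finset.mem_filter.1 hx
      obtain ⟨hz, hu⟩ := Finset.mem_product.1 hx
      have hz' := hZ _ hz
      have hu' := mem_missing.1 hu
      exact ⟨hle, hu'.1, Nat.dvd_sub hu'.2.1 hz'.2.1, fun h => hu'.2.2 (h.1 hz'.2.2)⟩
    have h2 : ({x ∈ Z ×ˢ U | x.2 ≤ x.1} : Finset (ℕ × ℕ)).card ≤ M * (L * (2 * E)) := by
      rw [← Finset.card_image_of_injective _ Prod.swap_injective]
      refine card_le_of_periodDefect hL hK _ fun y hy => ?_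
      obtain ⟨x, hx, rfl⟩ := Finset.mem_image.1 hy
      obtain ⟨hx, hle⟩ := Finset.mem_filter.1 hx
      obtain ⟨hz, hu⟩ := Finset.mem_product.1 hx
      have hz' := hZ _ hz
      have hu' := mem_missing.1 hu
      exact ⟨hle, hz'.1, Nat.dvd_sub hz'.2.1 hu'.2.1, fun h => hu'.2.2 (h.2 hz'.2.2)⟩
    have := (Finset.card_le_card hsub).trans (Finset.card_union_le _ _)
    rw [Finset.card_product] at this
    omega
  calc U.card * n ≤ U.card * (Z.card + E) := Nat.mul_le_mul_left _ hZn
    _ = U.card * E + Z.card * U.card := by ring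
    _ ≤ _ := by omega

/-- If `T l` is a set of positive density of almost-periods of `D` for every large `l`, then
almost all multiples of a fixed integer belong to `D`. -/
theorem tendsto_card_missing {D : Set ℕ} {T : ℕ → Finset ℕ} {m l₀ : ℕ} (hm : 0 < m) (h0 : 0 ∈ D)
    (hT : ∀ l, ∀ b ∈ T l, 0 < b ∧ b < l)
    (hcl : ∀ l, ∀ b ∈ T l, ∀ a ∈ D, a + b < l → a + b ∈ D)
    (hcard : ∀ l ≥ l₀, l ≤ m * (T l).card) {ε : ℝ} (hε : 0 < ε) :
    ∃ N₀, ∀ N ≥ N₀, ((missing D (8 * m).factorial N).card : ℝ) ≤ ε * N := by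
  classical
  set L := (8 * m).factorial with hLdef
  have hL : 0 < L := Nat.factorial_pos _
  have hLr : (0 : ℝ) < L := by exact_mod_cast hL
  have hmr : (0 : ℝ) < m := by exact_mod_cast hm
  -- `c * l` is a lower bound for `n` in `card_missing_mul_le` once `l ≥ 64 * m ^ 2 * L`. The bound
  -- `ν ≤ c / 2` absorbs the term with `E` on its right side, and the other bound on `ν` makes the
  -- remaining term small.
  set c : ℝ := 1 / (64 * m ^ 2 * L) with hc
  have hc0 : 0 < c := by positivity
  set ν : ℝ := min (c / 2) (ε * c / (16 * L * m)) with hν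
  have hν0 : 0 < ν := by positivity
  obtain ⟨Y₀, hY₀⟩ := exists_scale_shiftDefect_le hm hT hcl hcard hν0
  refine ⟨max (max Y₀ l₀) (64 * m ^ 2 * L), fun N hN => ?_⟩
  simp only [ge_iff_le, max_le_iff] at hN
  have hN1 : 0 < N := by
    have : 0 < 64 * m ^ 2 * L := by positivity
    omega
  have hNY : N ≤ 4 * m * N := Nat.le_mul_of_pos_left N (by omega)
  -- Starting at `4 * m * N` places `M = l / (4 * m)` between `N` and `2 * m * N`.
  obtain ⟨l, hl1, hl2, hl3⟩ := hY₀ (4 * m * N) (by omega)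
  set T' : Finset ℕ := {b ∈ T l | l ≤ 4 * m * b ∧ l ≤ 4 * m * (l - b)} with hT'
  set M := l / (4 * m) with hM
  have hNM : N ≤ M := (Nat.le_div_iff_mul_le (by omega)).2 (by linarith)
  have hl16 : 16 * m ≤ l := by
    have : 16 * m ≤ 64 * m ^ 2 * L := by nlinarith [Nat.mul_le_mul (Nat.le_self_pow two_ne_zero m) hL]
    omega
  have hcardT : l ≤ 4 * m * T'.card := by
    have h1 := hcard l (by omega)
    have hsub : T l ⊆ T' ∪ (Finset.range (M + 1) ∪ Finset.Ico (l - M - 1) l) := by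
      intro b hb
      have hbl := hT l b hb
      simp only [T', Finset.mem_union, Finset.mem_filter, Finset.mem_range, Finset.mem_Ico]
      by_cases h2 : b ≤ M
      · right; left; omega
      by_cases h3 : l - M - 1 ≤ b
      · right; right; omega
      left
      have h4 : l < (M + 1) * (4 * m) := Nat.lt_mul_of_div_lt (Nat.lt_succ_self _) (by omega)
      refine ⟨hb, ?_, ?_⟩
      · have : (M + 1) * (4 * m) ≤ b * (4 * m) := Nat.mul_le_mul_right _ (by omega)
        linarith
      · have : (M + 1) * (4 * m) ≤ (l - b) * (4 * m) := Nat.mul_le_mul_right _ (by omega)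
        linarith
    have h2 := (Finset.card_le_card hsub).trans ((Finset.card_union_le _ _).trans
      (Nat.add_le_add_left (Finset.card_union_le _ _) _))
    simp only [Finset.card_range, Nat.card_Ico] at h2
    have h3 : (T l).card ≤ T'.card + 2 * M + 2 := by omega
    have h4 : M * (4 * m) ≤ l := Nat.div_mul_le_self _ _
    nlinarith
  have hmain := card_missing_mul_le (E := ⌊ν * l⌋₊) hm h0 (by omega : 4 * m ≤ l) (T := T')
    (fun b hb => (hT l b (Finset.mem_filter.1 hb).1).2) (fun b hb => (Finset.mem_filter.1 hb).2.2)
    (fun b hb => hcl l b (Finset.mem_filter.1 hb).1)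
    (fun b hb => Nat.le_floor (hl3 b (Finset.mem_filter.1 hb).1 (Finset.mem_filter.1 hb).2.1
      (Finset.mem_filter.1 hb).2.2)) hcardT
  rw [← hLdef, ← hM] at hmain
  set u := (missing D L M).card with hu
  have hlr : (0 : ℝ) < l := by exact_mod_cast (by omega : 0 < l)
  have hfl : ((⌊ν * l⌋₊ : ℕ) : ℝ) ≤ ν * l := Nat.floor_le (by positivity)
  have hnlow : c * l ≤ ((T'.card / (8 * m * L) : ℕ) : ℝ) := by
    have h1 : T'.card < (T'.card / (8 * m * L) + 1) * (8 * m * L) :=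
      Nat.lt_mul_of_div_lt (Nat.lt_succ_self _) (by positivity)
    have h2 : (T'.card : ℝ) < (((T'.card / (8 * m * L) : ℕ) : ℝ) + 1) * (8 * m * L) := by
      exact_mod_cast h1
    have h3 : (l : ℝ) ≤ 4 * m * T'.card := by exact_mod_cast hcardT
    have h4 : (64 * m ^ 2 * L : ℝ) ≤ l := by exact_mod_cast (by omega : 64 * m ^ 2 * L ≤ l)
    rw [hc, div_mul_eq_mul_div, one_mul, div_le_iff₀ (by positivity)]
    nlinarith
  have hML : (M : ℝ) ≤ 2 * m * N := by
    have h1 : M ≤ 2 * m * N := by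
      refine Nat.div_le_of_le_mul ?_
      linarith
    exact_mod_cast h1
  have hmain' : (u : ℝ) * ((T'.card / (8 * m * L) : ℕ) : ℝ) ≤
      u * ((⌊ν * l⌋₊ : ℕ) : ℝ) + 2 * (M * (L * (2 * ((⌊ν * l⌋₊ : ℕ) : ℝ)))) := by
    exact_mod_cast hmain
  have hν1 : ν ≤ c / 2 := min_le_left _ _
  have hν2 : ν * (16 * L * m) ≤ ε * c := by
    rw [← le_div_iff₀ (by positivity)]
    exact min_le_right _ _
  have hu0 : (0 : ℝ) ≤ u := Nat.cast_nonneg _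
  have hbound : (u : ℝ) * (c / 2) ≤ 4 * M * L * ν := by
    have h1 : (u : ℝ) * (c * l) ≤ u * (ν * l) + 2 * (M * (L * (2 * (ν * l)))) :=
      (mul_le_mul_of_nonneg_left hnlow hu0).trans (hmain'.trans (by gcongr))
    have h2 : (u : ℝ) * (ν * l) ≤ u * (c / 2 * l) := by gcongr
    have h3 : (u : ℝ) * (c / 2) * l ≤ 4 * M * L * ν * l := by nlinarith
    exact le_of_mul_le_mul_right h3 hlr
  have hfin : (u : ℝ) ≤ ε * N := by
    have h1 : 4 * M * L * ν ≤ 4 * (2 * m * N) * L * ν := by gcongr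
    have h2 : (N : ℝ) * (ν * (16 * L * m)) ≤ N * (ε * c) := by gcongr
    have h3 : (u : ℝ) * (c / 2) ≤ ε * N * (c / 2) := by nlinarith
    exact le_of_mul_le_mul_right h3 (by positivity)
  refine le_trans ?_ hfin
  have : missing D L N ⊆ missing D L M := by
    intro y hy
    rw [mem_missing] at hy ⊢
    exact ⟨by omega, hy.2⟩
  exact_mod_cast Finset.card_le_card this

/-! ### Densities and the reduction to residue classes. -/

lemma abs_card_below_sub_countUpTo_le (S : Set ℕ) (n : ℕ) :
    |((below S n).card : ℝ) - countUpTo S n| ≤ 1 := by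
  classical
  have hfin : (S ∩ Set.Icc 1 n).Finite := (Set.finite_Icc 1 n).inter_of_right S
  have hc : countUpTo S n = hfin.toFinset.card := Set.ncard_eq_toFinset_card _ hfin
  have h1 : below S n ⊆ insert 0 hfin.toFinset := by
    intro x hx
    rw [mem_below] at hx
    simp only [Finset.mem_insert, Set.Finite.mem_toFinset, Set.mem_inter_iff, Set.mem_Icc]
    rcases Nat.eq_zero_or_pos x with h | h
    · exact Or.inl h
    · exact Or.inr ⟨hx.2, h, hx.1.le⟩
  have h2 : hfin.toFinset ⊆ insert n (below S n) := by
    intro x hx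
    simp only [Finset.mem_insert, Set.Finite.mem_toFinset, Set.mem_inter_iff, Set.mem_Icc,
      mem_below] at hx ⊢
    rcases hx.2.2.eq_or_lt with h | h
    · exact Or.inl h
    · exact Or.inr ⟨h, hx.1⟩
  have h1' : ((below S n).card : ℝ) ≤ countUpTo S n + 1 := by
    rw [hc]; exact_mod_cast (Finset.card_le_card h1).trans (Finset.card_insert_le _ _)
  have h2' : (countUpTo S n : ℝ) ≤ (below S n).card + 1 := by
    rw [hc]; exact_mod_cast (Finset.card_le_card h2).trans (Finset.card_insert_le _ _)
  rw [abs_le]; constructor <;> linarith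

lemma hasDensity_iff {S : Set ℕ} {d : ℝ} :
    HasDensity S d ↔ ∀ ε > 0, ∃ N₀ : ℕ, ∀ N ≥ N₀, |((below S N).card : ℝ) - d * N| ≤ ε * N := by
  rw [HasDensity, Metric.tendsto_atTop]
  constructor
  · intro h ε hε
    obtain ⟨N₀, hN₀⟩ := h (ε / 2) (by positivity)
    obtain ⟨N₁, hN₁⟩ := exists_nat_gt (2 / ε)
    refine ⟨max (max N₀ N₁) 1, fun N hN => ?_⟩
    simp only [ge_iff_le, max_le_iff] at hN
    have hN0 : (0 : ℝ) < N := by exact_mod_cast hN.2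
    have h1 := (hN₀ N hN.1.1).le
    have h2 : (2 / ε : ℝ) ≤ N := hN₁.le.trans (by exact_mod_cast hN.1.2)
    rw [div_le_iff₀ hε] at h2
    rw [Real.dist_eq, div_sub' hN0.ne', abs_div, abs_of_pos hN0, div_le_iff₀ hN0] at h1
    have h3 := abs_card_below_sub_countUpTo_le S N
    rw [abs_le] at *
    constructor <;> nlinarith
  · intro h ε hε
    obtain ⟨N₀, hN₀⟩ := h (ε / 4) (by positivity)
    obtain ⟨N₁, hN₁⟩ := exists_nat_gt (4 / ε)
    refine ⟨max (max N₀ N₁) 1, fun N hN => ?_⟩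
    simp only [ge_iff_le, max_le_iff] at hN
    have hN0 : (0 : ℝ) < N := by exact_mod_cast hN.2
    have h1 := hN₀ N hN.1.1
    have h2 : (4 / ε : ℝ) ≤ N := hN₁.le.trans (by exact_mod_cast hN.1.2)
    rw [div_le_iff₀ hε] at h2
    rw [Real.dist_eq, div_sub' hN0.ne', abs_div, abs_of_pos hN0, div_lt_iff₀ hN0]
    have h3 := abs_card_below_sub_countUpTo_le S N
    rw [abs_le] at *
    rw [abs_lt]
    constructor <;> nlinarith

lemma card_below_translate_le (S : Set ℕ) (a N : ℕ) :
    (below {n | a + n ∈ S} N).card ≤ (below S N).card + a := by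
  classical
  have h : (below {n | a + n ∈ S} N).image (a + ·) ⊆ below S N ∪ Finset.Ico N (N + a) := by
    intro x hx
    obtain ⟨n, hn, rfl⟩ := Finset.mem_image.1 hx
    simp only [mem_below, Set.mem_ofPred_eq, Finset.mem_union, Finset.mem_Ico] at hn ⊢
    by_cases h : a + n < N
    · exact Or.inl ⟨h, hn.2⟩
    · exact Or.inr ⟨by omega, by omega⟩
  have := (Finset.card_le_card h).trans (Finset.card_union_le _ _)
  rw [Finset.card_image_of_injective _ (add_right_injective a)] at this
  simpa using this

lemma card_below_le_translate (S : Set ℕ) (a N : ℕ) :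
    (below S N).card ≤ (below {n | a + n ∈ S} N).card + a := by
  classical
  have h : below S N ⊆ (below {n | a + n ∈ S} N).image (a + ·) ∪ Finset.range a := by
    intro x hx
    rw [mem_below] at hx
    simp only [Finset.mem_union, Finset.mem_image, mem_below, Set.mem_ofPred_eq, Finset.mem_range]
    by_cases h : x < a
    · exact Or.inr h
    · refine Or.inl ⟨x - a, ⟨by omega, ?_⟩, by omega⟩
      rw [Nat.add_sub_cancel' (by omega)]; exact hx.2
  have := (Finset.card_le_card h).trans (Finset.card_union_le _ _)
  have h2 := Finset.card_image_le (s := below {n | a + n ∈ S} N) (f := (a + ·))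
  simp only [Finset.card_range] at this
  omega

/-- If `d(2A) < 2 d(A)`, then `2A` contains almost all of `c + L ℕ` for each of its elements `c`,
with a modulus `L` independent of `c`. -/
theorem exists_modulus_tendsto_missing {A : Set ℕ} {α β : ℝ} (hA : HasDensity A α)
    (hC : HasDensity (A + A) β) (h : β < 2 * α) :
    ∃ L : ℕ, 0 < L ∧ ∀ c ∈ A + A, ∀ ε > 0, ∃ N₀, ∀ N ≥ N₀,
      ((missing {n | c + n ∈ A + A} L N).card : ℝ) ≤ ε * N := by
  -- `m` is fixed before `c`, so that the modulus does not depend on `c`.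
  obtain ⟨m, hm⟩ := exists_nat_gt (2 / (2 * α - β))
  have hδ : 0 < 2 * α - β := by linarith
  have hm0 : 0 < m := by
    have : (0 : ℝ) < m := lt_trans (by positivity) hm
    exact_mod_cast this
  refine ⟨(8 * m).factorial, Nat.factorial_pos _, ?_⟩
  rintro c ⟨a, ha, a', ha', rfl⟩ ε hε
  obtain ⟨D, T, h0, hDC, hT, hcl, hcount⟩ := exists_dyson_closure (A := {n | a + n ∈ A})
    (B := {n | a' + n ∈ A}) (C := {n | a + a' + n ∈ A + A}) (by simpa using ha) (by simpa using ha')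
    (fun x hx y hy => ⟨a + x, hx, a' + y, hy, by simp only; ring⟩)
  rw [hasDensity_iff] at hA hC
  obtain ⟨N₁, hN₁⟩ := hA ((2 * α - β) / 8) (by positivity)
  obtain ⟨N₂, hN₂⟩ := hC ((2 * α - β) / 8) (by positivity)
  obtain ⟨N₃, hN₃⟩ := exists_nat_gt (8 * (2 * (a + a') + 1 : ℝ) / (2 * α - β))
  have hcard : ∀ l ≥ max (max N₁ N₂) N₃, l ≤ m * (T l).card := by
    intro l hl
    simp only [ge_iff_le, max_le_iff] at hl
    have i1 := (abs_le.1 (hN₁ l hl.1.1)).1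
    have i2 := (abs_le.1 (hN₂ l hl.1.2)).2
    have i3 : (8 * (2 * (a + a') + 1 : ℝ) / (2 * α - β)) ≤ l :=
      hN₃.le.trans (by exact_mod_cast hl.2)
    rw [div_le_iff₀ hδ] at i3
    have j1 := card_below_le_translate A a l
    have j2 := card_below_le_translate A a' l
    have j3 := card_below_translate_le (A + A) (a + a') l
    have j4 := hcount l
    have j5 : (below D l).card ≤ (below {n | a + a' + n ∈ A + A} l).card := by
      refine Finset.card_le_card fun x hx => ?_
      rw [mem_below] at hx ⊢
      exact ⟨hx.1, hDC hx.2⟩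
    have j6 : 2 * ((below A l).card : ℝ) ≤ (below (A + A) l).card + (T l).card + 2 * (a + a') + 1 := by
      exact_mod_cast (by omega : 2 * (below A l).card ≤
        (below (A + A) l).card + (T l).card + 2 * (a + a') + 1)
    have j7 : (2 * α - β) / 2 * l ≤ (T l).card := by nlinarith
    rw [div_lt_iff₀ hδ] at hm
    have hl0 : (0 : ℝ) ≤ l := Nat.cast_nonneg l
    have hmr : (0 : ℝ) < m := by exact_mod_cast hm0
    have : (l : ℝ) ≤ m * (T l).card := by nlinarith [mul_le_mul_of_nonneg_left j7 hmr.le]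
    exact_mod_cast this
  obtain ⟨N₀, hN₀⟩ := tendsto_card_missing hm0 h0 hT hcl hcard hε
  refine ⟨N₀, fun N hN => le_trans ?_ (hN₀ N hN)⟩
  have : missing {n | a + a' + n ∈ A + A} (8 * m).factorial N ⊆
      missing D (8 * m).factorial N := by
    intro x hx
    rw [mem_missing] at hx ⊢
    exact ⟨hx.1, hx.2.1, fun h => hx.2.2 (hDC h)⟩
  exact_mod_cast Finset.card_le_card this

/-- The natural numbers whose residue modulo `L` lies in `R`. -/
def residueSet {L : ℕ} (R : Finset (ZMod L)) : Set ℕ := {n | (n : ZMod L) ∈ R}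

lemma card_below_residueSet_le {L : ℕ} [NeZero L] (R : Finset (ZMod L)) (N : ℕ) :
    (below (residueSet R) N).card ≤ R.card * (N / L + 1) := by
  classical
  have h : below (residueSet R) N ⊆
      (R ×ˢ Finset.range (N / L + 1)).image fun x => x.1.val + L * x.2 := by
    intro n hn
    rw [mem_below] at hn
    refine Finset.mem_image.2 ⟨((n : ZMod L), n / L), ?_, ?_⟩
    · simp only [Finset.mem_product, Finset.mem_range]
      exact ⟨hn.2, Nat.lt_succ_of_le (Nat.div_le_div_right hn.1.le)⟩
    · simp only [ZMod.val_natCast]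
      exact Nat.mod_add_div n L
  simpa [Finset.card_product] using (Finset.card_le_card h).trans Finset.card_image_le

lemma le_card_below_residueSet {L : ℕ} [NeZero L] (R : Finset (ZMod L)) (N : ℕ) :
    R.card * (N / L) ≤ (below (residueSet R) N).card := by
  classical
  have hinj : Function.Injective fun x : ZMod L × ℕ => x.1.val + L * x.2 := by
    rintro ⟨x, i⟩ ⟨y, j⟩ hxy
    simp only at hxy
    have e : x = y := by
      have := congrArg (Nat.cast : ℕ → ZMod L) hxy
      simpa using this
    subst e
    have := Nat.eq_of_mul_eq_mul_left (NeZero.pos L) (Nat.add_left_cancel hxy)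
    rw [this]
  have h : (R ×ˢ Finset.range (N / L)).image (fun x => x.1.val + L * x.2) ⊆
      below (residueSet R) N := by
    intro n hn
    obtain ⟨⟨x, i⟩, hx, rfl⟩ := Finset.mem_image.1 hn
    simp only [Finset.mem_product, Finset.mem_range] at hx
    refine mem_below.2 ⟨?_, by simpa [residueSet] using hx.1⟩
    have h1 : x.val < L := ZMod.val_lt x
    have h2 : L * (i + 1) ≤ L * (N / L) := Nat.mul_le_mul_left L hx.2
    have h3 := Nat.mul_div_le N L
    simp only
    rw [mul_add] at h2
    omega
  have := Finset.card_le_card h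
  rwa [Finset.card_image_of_injective _ hinj, Finset.card_product, Finset.card_range] at this

lemma hasDensity_residueSet {L : ℕ} [NeZero L] (R : Finset (ZMod L)) :
    HasDensity (residueSet R) (R.card / L) := by
  rw [hasDensity_iff]
  intro ε hε
  obtain ⟨N₀, hN₀⟩ := exists_nat_gt ((R.card : ℝ) / ε)
  refine ⟨N₀, fun N hN => ?_⟩
  have h1 : ((below (residueSet R) N).card : ℝ) ≤ R.card * (((N / L : ℕ) : ℝ) + 1) := by
    exact_mod_cast card_below_residueSet_le R N
  have h2 : (R.card : ℝ) * ((N / L : ℕ) : ℝ) ≤ (below (residueSet R) N).card := by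
    exact_mod_cast le_card_below_residueSet R N
  have h3 : ((N / L : ℕ) : ℝ) ≤ N / L := Nat.cast_div_le
  have hL : (0 : ℝ) < L := by exact_mod_cast NeZero.pos L
  have h4 : (N : ℝ) / L ≤ ((N / L : ℕ) : ℝ) + 1 := by
    rw [div_le_iff₀ hL]
    have : N < (N / L + 1) * L := Nat.lt_mul_of_div_lt (Nat.lt_succ_self _) (NeZero.pos L)
    exact_mod_cast this.le
  have h5 : (R.card : ℝ) ≤ ε * N := by
    have : (R.card : ℝ) / ε ≤ N := hN₀.le.trans (by exact_mod_cast hN)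
    rwa [div_le_iff₀' hε] at this
  have h6 : (R.card : ℝ) / L * N = R.card * (N / L) := by ring
  have hR : (0 : ℝ) ≤ R.card := Nat.cast_nonneg _
  rw [abs_le, h6]
  constructor <;> nlinarith

/-- Comparison of densities of sets that are ordered up to a set of density zero. -/
lemma HasDensity.le_of_eventually {S S' : Set ℕ} {d d' : ℝ} (hS : HasDensity S d)
    (hS' : HasDensity S' d')
    (h : ∀ ε > 0, ∃ N₀ : ℕ, ∀ N ≥ N₀, ((below S N).card : ℝ) ≤ (below S' N).card + ε * N) :
    d ≤ d' := by
  rw [hasDensity_iff] at hS hS'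
  refine le_of_forall_pos_le_add fun ε hε => ?_
  obtain ⟨N₁, hN₁⟩ := hS (ε / 3) (by positivity)
  obtain ⟨N₂, hN₂⟩ := hS' (ε / 3) (by positivity)
  obtain ⟨N₃, hN₃⟩ := h (ε / 3) (by positivity)
  set N := max (max N₁ N₂) (max N₃ 1)
  have i1 := (abs_le.1 (hN₁ N (by simp [N]))).1
  have i2 := (abs_le.1 (hN₂ N (by simp [N]))).2
  have i3 := hN₃ N (by simp [N])
  have i4 : (0 : ℝ) < N := by exact_mod_cast (by simp [N] : 0 < N)
  refine le_of_mul_le_mul_right ?_ i4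
  linarith

lemma HasDensity.mono {S S' : Set ℕ} {d d' : ℝ} (hS : HasDensity S d)
    (hS' : HasDensity S' d') (h : S ⊆ S') : d ≤ d' := by
  refine hS.le_of_eventually hS' fun ε hε => ⟨0, fun N _ => ?_⟩
  have : (below S N).card ≤ (below S' N).card := by
    refine Finset.card_le_card fun x hx => ?_
    rw [mem_below] at hx ⊢
    exact ⟨hx.1, h hx.2⟩
  have : ((below S N).card : ℝ) ≤ (below S' N).card := by exact_mod_cast this
  have : 0 ≤ ε * N := by positivity
  linarith

/-- If `d(2A) < 2 d(A)`, then for a suitable modulus the density of `2A` is that of the union of the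
residue classes which it meets. -/
theorem exists_residues {A : Set ℕ} {α β : ℝ} (hA : HasDensity A α)
    (hC : HasDensity (A + A) β) (h : β < 2 * α) :
    ∃ (L : ℕ) (_ : NeZero L) (S : Finset (ZMod L)),
      α ≤ S.card / L ∧ β = ((S + S).card : ℝ) / L := by
  classical
  obtain ⟨L, hL, hmiss⟩ := exists_modulus_tendsto_missing hA hC h
  have : NeZero L := ⟨hL.ne'⟩
  let S : Finset (ZMod L) := {x | ∃ a ∈ A, (a : ZMod L) = x}
  have hAS : A ⊆ residueSet S := fun a ha => by
    simp only [residueSet, S, Set.mem_ofPred_eq, Finset.mem_filter, Finset.mem_univ, true_and]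
    exact ⟨a, ha, rfl⟩
  refine ⟨L, inferInstance, S, hA.mono (hasDensity_residueSet S) hAS, le_antisymm ?_ ?_⟩
  · refine hC.mono (hasDensity_residueSet (S + S)) ?_
    rintro _ ⟨a, ha, b, hb, rfl⟩
    simp only [residueSet, Set.mem_ofPred_eq, Nat.cast_add]
    exact Finset.add_mem_add (hAS ha) (hAS hb)
  -- Each class in `S + S` contains some `c x` in `A + A`, and then almost all of `c x + L ℕ`
  -- belongs to `A + A`.
  · have hrep : ∀ x : ZMod L, ∃ c, x ∈ S + S → c ∈ A + A ∧ (c : ZMod L) = x := by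
      intro x
      by_cases hx : x ∈ S + S
      · obtain ⟨y, hy, z, hz, rfl⟩ := Finset.mem_add.1 hx
        obtain ⟨a, ha, rfl⟩ := (Finset.mem_filter.1 hy).2
        obtain ⟨b, hb, rfl⟩ := (Finset.mem_filter.1 hz).2
        exact ⟨a + b, fun _ => ⟨Set.add_mem_add ha hb, by push_cast; rfl⟩⟩
      · exact ⟨0, fun h => absurd h hx⟩
    choose c hc using hrep
    refine (hasDensity_residueSet (S + S)).le_of_eventually hC fun ε hε => ?_
    have hLr : (0 : ℝ) < L := by exact_mod_cast hL
    have hN : ∀ x : ZMod L, ∃ N₀, x ∈ S + S → ∀ N ≥ N₀,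
        ((missing {n | c x + n ∈ A + A} L N).card : ℝ) ≤ ε / (2 * L) * N := by
      intro x
      by_cases hx : x ∈ S + S
      · obtain ⟨N₀, hN₀⟩ := hmiss (c x) (hc x hx).1 (ε / (2 * L)) (by positivity)
        exact ⟨N₀, fun _ => hN₀⟩
      · exact ⟨0, fun h => absurd h hx⟩
    choose N₀ hN₀ using hN
    obtain ⟨N₁, hN₁⟩ := exists_nat_gt ((∑ x ∈ S + S, c x : ℕ) / (ε / 2) : ℝ)
    refine ⟨max N₁ ((S + S).sup N₀), fun N hN => ?_⟩
    simp only [ge_iff_le, max_le_iff] at hN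
    have hsub : below (residueSet (S + S)) N ⊆ below (A + A) N ∪ (S + S).biUnion fun x =>
        Finset.range (c x) ∪ (missing {n | c x + n ∈ A + A} L N).image (c x + ·) := by
      intro n hn
      rw [mem_below] at hn
      by_cases hnC : n ∈ A + A
      · exact Finset.mem_union_left _ (mem_below.2 ⟨hn.1, hnC⟩)
      refine Finset.mem_union_right _ (Finset.mem_biUnion.2 ⟨(n : ZMod L), hn.2, ?_⟩)
      rcases lt_or_ge n (c n) with hlt | hge
      · exact Finset.mem_union_left _ (Finset.mem_range.2 hlt)
      · refine Finset.mem_union_right _ (Finset.mem_image.2 ⟨n - c n, ?_, by omega⟩)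
        rw [mem_missing]
        refine ⟨by omega, ?_, ?_⟩
        · exact (Nat.modEq_iff_dvd' hge).1 ((ZMod.natCast_eq_natCast_iff _ _ _).1 (hc n hn.2).2)
        · simpa [Nat.add_sub_cancel' hge] using hnC
    have h1 := (Finset.card_le_card hsub).trans (Finset.card_union_le _ _)
    have h2 : ((S + S).biUnion fun x => Finset.range (c x) ∪
        (missing {n | c x + n ∈ A + A} L N).image (c x + ·)).card ≤
        ∑ x ∈ S + S, (c x + (missing {n | c x + n ∈ A + A} L N).card) := by
      refine Finset.card_biUnion_le.trans (Finset.sum_le_sum fun x _ => ?_)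
      refine (Finset.card_union_le _ _).trans ?_
      rw [Finset.card_range]
      exact Nat.add_le_add_left Finset.card_image_le _
    rw [Finset.sum_add_distrib] at h2
    have h3 : ((∑ x ∈ S + S, (missing {n | c x + n ∈ A + A} L N).card : ℕ) : ℝ) ≤ ε / 2 * N := by
      push_cast
      calc _ ≤ ∑ x ∈ S + S, ε / (2 * L) * (N : ℝ) := Finset.sum_le_sum fun x hx =>
            hN₀ x hx N ((Finset.le_sup hx).trans hN.2)
        _ = (S + S).card * (ε / (2 * L) * N) := by rw [Finset.sum_const, nsmul_eq_mul]
        _ ≤ L * (ε / (2 * L) * N) := by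
            gcongr
            simpa using Finset.card_le_univ (S + S)
        _ = _ := by field_simp
    have h4 : ((∑ x ∈ S + S, c x : ℕ) : ℝ) ≤ ε / 2 * N := by
      have : ((∑ x ∈ S + S, c x : ℕ) / (ε / 2) : ℝ) ≤ N := hN₁.le.trans (by exact_mod_cast hN.1)
      rwa [div_le_iff₀' (by positivity)] at this
    have h5 : ((below (residueSet (S + S)) N).card : ℝ) ≤ (below (A + A) N).card +
        ((∑ x ∈ S + S, c x : ℕ) + (∑ x ∈ S + S, (missing {n | c x + n ∈ A + A} L N).card : ℕ)) := by
      exact_mod_cast h1.trans (Nat.add_le_add_left h2 _)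
    linarith

/-! ### Kneser's theorem in a finite abelian group. -/

section Kneser

variable {G : Type*} [AddCommGroup G]

/-- The finite set `C` is a union of cosets of a subgroup `H` with `k ≤ |C| + |H|`. -/
def IsPeriodicOfSize (k : ℕ) (C : Finset G) : Prop :=
  ∃ H : AddSubgroup G, (∀ x ∈ C, ∀ h ∈ H, x + h ∈ C) ∧ k ≤ C.card + Nat.card H

/-- The group of periods of a finite set. -/
def periods (C : Finset G) : AddSubgroup G where
  carrier := {h | ∀ x, x ∈ C ↔ x + h ∈ C}
  zero_mem' := by simp
  add_mem' {g h} hg hh x := by rw [hg x, hh (x + g), add_assoc]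
  neg_mem' {h} hh x := by rw [hh (x + -h), neg_add_cancel_right]

lemma mem_periods {C : Finset G} {h : G} : h ∈ periods C ↔ ∀ x, x ∈ C ↔ x + h ∈ C := Iff.rfl

lemma mem_periods_of_forall_mem {C : Finset G} {h : G} (H : ∀ x ∈ C, x + h ∈ C) :
    h ∈ periods C := by
  classical
  have himg : C.image (· + h) = C := by
    refine Finset.eq_of_subset_of_card_le (fun y hy => ?_) ?_
    · obtain ⟨x, hx, rfl⟩ := Finset.mem_image.1 hy
      exact H x hx
    · rw [Finset.card_image_of_injective _ (add_left_injective h)]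
  refine mem_periods.2 fun x => ⟨H x, fun hx => ?_⟩
  rw [← himg] at hx
  obtain ⟨y, hy, hyx⟩ := Finset.mem_image.1 hx
  rwa [← add_right_cancel hyx]

lemma card_dvd_card_of_periodic {H : AddSubgroup G} {C : Finset G}
    (hC : ∀ x ∈ C, ∀ h ∈ H, x + h ∈ C) : Nat.card H ∣ C.card := by
  classical
  have e : (QuotientAddGroup.mk : G → G ⧸ H) ⁻¹' (QuotientAddGroup.mk '' (C : Set G)) = C := by
    refine Set.Subset.antisymm ?_ (Set.subset_preimage_image _ _)
    rintro x ⟨y, hy, hyx⟩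
    have := hC y hy _ (QuotientAddGroup.eq.1 hyx)
    simpa using this
  have h1 := Nat.card_congr
    (QuotientAddGroup.preimageMkEquivAddSubgroupProdSet H (QuotientAddGroup.mk '' (C : Set G)))
  rw [e, Nat.card_prod] at h1
  have h2 : Nat.card (C : Set G) = C.card := by simp
  exact ⟨_, by rw [← h2]; exact h1⟩

/-- Pairs with the same value of `x + y - c` differ by an element of `H₁ ⊓ H₂` in the first
coordinate, which determines the second. -/
lemma card_mul_card_le_of_cosets [Finite G] {H₁ H₂ : AddSubgroup G} {c : G} {X Y Z : Finset G}
    (hX : ∀ x ∈ X, x - c ∈ H₂) (hY : ∀ y ∈ Y, y - c ∈ H₁)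
    (hZ : ∀ x ∈ X, ∀ y ∈ Y, x + y - c ∈ Z) :
    X.card * Y.card ≤ Nat.card (H₁ ⊓ H₂ : AddSubgroup G) * Z.card := by
  classical
  rw [← Finset.card_product]
  refine Finset.card_le_mul_card_image_of_maps_to (f := fun p : G × G => p.1 + p.2 - c) (t := Z)
    (fun p hp => hZ _ (Finset.mem_product.1 hp).1 _ (Finset.mem_product.1 hp).2) _ fun z _ => ?_
  rcases Finset.eq_empty_or_nonempty {p ∈ X ×ˢ Y | p.1 + p.2 - c = z} with h | ⟨p₀, hp₀⟩
  · rw [h]; simp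
  · obtain ⟨hm₀, he₀⟩ := Finset.mem_filter.1 hp₀
    have hm₀' := Finset.mem_product.1 hm₀
    have key : ∀ p ∈ ({p ∈ X ×ˢ Y | p.1 + p.2 - c = z} : Finset (G × G)),
        p.1 - p₀.1 ∈ ((H₁ ⊓ H₂ : AddSubgroup G) : Set G) := by
      intro p hp
      obtain ⟨hm, he⟩ := Finset.mem_filter.1 hp
      have hm' := Finset.mem_product.1 hm
      refine ⟨?_, ?_⟩
      · have h1 := H₁.sub_mem (hY _ hm₀'.2) (hY _ hm'.2)
        have h2 : p.1 - p₀.1 = p₀.2 - c - (p.2 - c) := by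
          have := he.trans he₀.symm
          have h3 : p.1 + p.2 = p₀.1 + p₀.2 := sub_left_injective this
          rw [sub_sub_sub_cancel_right, sub_eq_sub_iff_add_eq_add, h3, add_comm]
        rw [h2]; exact h1
      · have h1 := H₂.sub_mem (hX _ hm'.1) (hX _ hm₀'.1)
        rwa [sub_sub_sub_cancel_right] at h1
    have hfin : ((H₁ ⊓ H₂ : AddSubgroup G) : Set G).Finite := Set.toFinite _
    have hcard : Nat.card (H₁ ⊓ H₂ : AddSubgroup G) = hfin.toFinset.card :=
      Nat.card_eq_card_finite_toFinset hfin
    rw [hcard]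
    refine Finset.card_le_card_of_injOn (fun p => p.1 - p₀.1)
      (fun p hp => hfin.mem_toFinset.2 (key p hp)) fun p hp q hq hpq => ?_
    have e1 : p.1 = q.1 := sub_left_injective hpq
    have e2 := (Finset.mem_filter.1 hp).2.trans (Finset.mem_filter.1 hq).2.symm
    have e3 : p.1 + p.2 = q.1 + q.2 := sub_left_injective e2
    rw [e1] at e3
    exact Prod.ext e1 (add_left_cancel e3)

/-- If `C₁ ⊆ C₂` fails at `c`, the period group `H₁ ⊓ H₂` works. Split `c + H₂` by `C₁` into `P`,
`P'` and `c + H₁` by `C₂` into `Q'`, `Q`; then `P + Q - c ⊆ C₁ \ C₂` and `P' + Q' - c ⊆ C₂ \ C₁`, so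
both differences are too large for the bound to fail. -/
lemma isPeriodicOfSize_union_of_card_le [Finite G] [DecidableEq G] {k : ℕ} {C₁ C₂ : Finset G}
    {H₁ H₂ : AddSubgroup G} (h₁ : ∀ x ∈ C₁, ∀ h ∈ H₁, x + h ∈ C₁)
    (h₂ : ∀ x ∈ C₂, ∀ h ∈ H₂, x + h ∈ C₂) (hk₁ : k ≤ C₁.card + Nat.card H₁)
    (hk₂ : k ≤ C₂.card + Nat.card H₂) (hle : Nat.card H₂ ≤ Nat.card H₁) :
    IsPeriodicOfSize k (C₁ ∪ C₂) := by
  classical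
  have := Fintype.ofFinite G
  by_cases hsub : C₁ ⊆ C₂
  · rw [Finset.union_eq_right.2 hsub]
    exact ⟨H₂, h₂, hk₂⟩
  obtain ⟨c, hc1, hc2⟩ := Finset.not_subset.1 hsub
  refine ⟨H₁ ⊓ H₂, ?_, ?_⟩
  · intro x hx h hh
    rcases Finset.mem_union.1 hx with hx | hx
    · exact Finset.mem_union_left _ (h₁ x hx h hh.1)
    · exact Finset.mem_union_right _ (h₂ x hx h hh.2)
  by_contra! hlt
  have h₁' : ∀ x, ∀ h ∈ H₁, x + h ∈ C₁ → x ∈ C₁ := fun x h hh hx => by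
    simpa using h₁ _ hx (-h) (H₁.neg_mem hh)
  have h₂' : ∀ x, ∀ h ∈ H₂, x + h ∈ C₂ → x ∈ C₂ := fun x h hh hx => by
    simpa using h₂ _ hx (-h) (H₂.neg_mem hh)
  set κ := Nat.card (H₁ ⊓ H₂ : AddSubgroup G) with hκ
  have hcos : ∀ H : AddSubgroup G,
      ({x | x - c ∈ H} : Finset G).card = Nat.card H := by
    intro H
    have hcard : Nat.card H = (Set.toFinite (H : Set G)).toFinset.card :=
      Nat.card_eq_card_finite_toFinset _
    rw [hcard]
    refine Finset.card_bij (fun x _ => x - c) (fun x hx => by simpa using hx)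
      (fun x _ y _ hxy => sub_left_injective hxy) fun y hy => ⟨y + c, by simpa using hy, by simp⟩
  set P : Finset G := {x ∈ ({x | x - c ∈ H₂} : Finset G) | x ∈ C₁} with hP
  set P' : Finset G := {x ∈ ({x | x - c ∈ H₂} : Finset G) | x ∉ C₁} with hP'
  set Q' : Finset G := {x ∈ ({x | x - c ∈ H₁} : Finset G) | x ∈ C₂} with hQ'
  set Q : Finset G := {x ∈ ({x | x - c ∈ H₁} : Finset G) | x ∉ C₂} with hQ
  have cP : P.card + P'.card = Nat.card H₂ := by
    rw [← hcos H₂]; exact Finset.card_filter_add_card_filter_not _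
  have cQ : Q'.card + Q.card = Nat.card H₁ := by
    rw [← hcos H₁]; exact Finset.card_filter_add_card_filter_not _
  have hPQ : P.card * Q.card ≤ κ * (C₁ \ C₂).card := by
    refine card_mul_card_le_of_cosets (c := c) (fun x hx => by simp [hP] at hx; exact hx.1)
      (fun x hx => by simp [hQ] at hx; exact hx.1) fun x hx y hy => ?_
    simp only [hP, hQ, Finset.mem_filter, Finset.mem_univ, true_and] at hx hy
    refine Finset.mem_sdiff.2 ⟨?_, fun h => hy.2 (h₂' y (x - c) hx.1 ?_)⟩
    · have := h₁ x hx.2 _ hy.1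
      rwa [← add_sub_assoc] at this
    · rwa [← add_sub_assoc, add_comm y]
  have hPQ' : P'.card * Q'.card ≤ κ * (C₂ \ C₁).card := by
    refine card_mul_card_le_of_cosets (c := c) (fun x hx => by simp [hP'] at hx; exact hx.1)
      (fun x hx => by simp [hQ'] at hx; exact hx.1) fun x hx y hy => ?_
    simp only [hP', hQ', Finset.mem_filter, Finset.mem_univ, true_and] at hx hy
    refine Finset.mem_sdiff.2 ⟨?_, fun h => hx.2 (h₁' x (y - c) hy.1 ?_)⟩
    · have := h₂ y hy.2 _ hx.1
      rwa [← add_sub_assoc, add_comm y] at this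
    · rwa [← add_sub_assoc]
  have hκle : ∀ Z : Finset G, (∀ h ∈ H₁ ⊓ H₂, c + h ∈ Z) → κ ≤ Z.card := by
    intro Z hZ
    rw [hκ, ← hcos (H₁ ⊓ H₂)]
    refine Finset.card_le_card fun x hx => ?_
    have := hZ (x - c) (by simpa using hx)
    rwa [add_sub_cancel] at this
  have hκP : κ ≤ P.card := hκle P fun h hh => by
    simp only [hP, Finset.mem_filter, Finset.mem_univ, true_and, add_sub_cancel_left]
    exact ⟨hh.2, h₁ c hc1 h hh.1⟩
  have hκQ : κ ≤ Q.card := hκle Q fun h hh => by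
    simp only [hQ, Finset.mem_filter, Finset.mem_univ, true_and, add_sub_cancel_left]
    exact ⟨hh.1, fun h' => hc2 (h₂' c h hh.2 h')⟩
  have hu₁ : (C₁ ∪ C₂).card = C₂.card + (C₁ \ C₂).card := by
    rw [Finset.union_comm, ← Finset.union_sdiff_self_eq_union,
      Finset.card_union_of_disjoint Finset.disjoint_sdiff]
  have hu₂ : (C₁ ∪ C₂).card = C₁.card + (C₂ \ C₁).card := by
    rw [← Finset.union_sdiff_self_eq_union, Finset.card_union_of_disjoint Finset.disjoint_sdiff]
  have d₁ : (C₁ \ C₂).card + κ + 1 ≤ Nat.card H₂ := by omega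
  have d₂ : (C₂ \ C₁).card + κ + 1 ≤ Nat.card H₁ := by omega
  have hκ0 : 0 < κ := Nat.card_pos
  generalize P.card = p at *
  generalize Q.card = q at *
  generalize P'.card = p' at *
  generalize Q'.card = q' at *
  generalize (C₁ \ C₂).card = x at *
  generalize (C₂ \ C₁).card = y at *
  generalize Nat.card H₁ = n₁ at *
  generalize Nat.card H₂ = n₂ at *
  subst cP cQ
  zify at *
  -- From `p, q ≥ κ` one gets `q < p'`, and `n₂ ≤ n₁` then gives `q' > p ≥ κ`. Hence `p' * q' ≥ q *
  -- q' ≥ κ * (q + q' - κ) > κ * y`, a contradiction.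
  have e1 : (κ : ℤ) * (p + q - κ) ≤ p * q := by nlinarith
  have e2 : (κ : ℤ) * (p + q - κ) < κ * (p + p' - κ) := by nlinarith
  have e3 : (p + q - κ : ℤ) < p + p' - κ := lt_of_mul_lt_mul_left e2 hκ0.le
  have e4 : (0 : ℤ) ≤ (q - κ) * (q' - κ) := mul_nonneg (by linarith) (by linarith)
  nlinarith

lemma IsPeriodicOfSize.union [Finite G] [DecidableEq G] {k : ℕ} {C₁ C₂ : Finset G}
    (h₁ : IsPeriodicOfSize k C₁) (h₂ : IsPeriodicOfSize k C₂) : IsPeriodicOfSize k (C₁ ∪ C₂) := by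
  obtain ⟨H₁, h₁, hk₁⟩ := h₁
  obtain ⟨H₂, h₂, hk₂⟩ := h₂
  rcases le_total (Nat.card H₂) (Nat.card H₁) with h | h
  · exact isPeriodicOfSize_union_of_card_le h₁ h₂ hk₁ hk₂ h
  · rw [Finset.union_comm]
    exact isPeriodicOfSize_union_of_card_le h₂ h₁ hk₂ hk₁ h

/-- The closure of a pair of finite sets under the Dyson transform. -/
lemma exists_dyson_closure_finset [DecidableEq G] (n : ℕ) : ∀ {A B C : Finset G}, B.card = n →
    0 ∈ A → 0 ∈ B → A + B ⊆ C → ∃ A' B' : Finset G, 0 ∈ A' ∧ A' ⊆ C ∧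
      (∀ a ∈ A', ∀ b ∈ B', a + b ∈ A') ∧ A.card + B.card ≤ A'.card + B'.card := by
  induction n using Nat.strong_induction_on with
  | _ n ih =>
    intro A B C hn hA hB hC
    by_cases h : ∀ a ∈ A, ∀ b ∈ B, a + b ∈ A
    · exact ⟨A, B, hA, fun a ha => hC (by simpa using Finset.add_mem_add ha hB), h, le_rfl⟩
    push Not at h
    obtain ⟨e, he, b₀, hb₀, hb₀'⟩ := h
    -- Moving `X` from `B` into `A`, translated by `e`, keeps the total size and shrinks `B`.
    set X : Finset G := {b ∈ B | e + b ∉ A} with hX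
    set B₁ : Finset G := {b ∈ B | e + b ∈ A} with hB₁
    have hcard : B₁.card + X.card = B.card := Finset.card_filter_add_card_filter_not _
    have hXpos : 0 < X.card := Finset.card_pos.2 ⟨b₀, Finset.mem_filter.2 ⟨hb₀, hb₀'⟩⟩
    have hdisj : Disjoint A (X.image (e + ·)) := by
      rw [Finset.disjoint_right]
      intro x hx
      obtain ⟨b, hb, rfl⟩ := Finset.mem_image.1 hx
      exact (Finset.mem_filter.1 hb).2
    have hA₁ : (A ∪ X.image (e + ·)).card = A.card + X.card := by
      rw [Finset.card_union_of_disjoint hdisj,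
        Finset.card_image_of_injective _ (add_right_injective e)]
    obtain ⟨A', B', h0, hA', hcl, hle⟩ := ih B₁.card (by omega) (A := A ∪ X.image (e + ·))
      (C := C) rfl (Finset.mem_union_left _ hA)
      (Finset.mem_filter.2 ⟨hB, by simpa using he⟩) (by
        rintro _ hx
        obtain ⟨a, ha, b, hb, rfl⟩ := Finset.mem_add.1 hx
        obtain ⟨hb, hb'⟩ := Finset.mem_filter.1 hb
        rcases Finset.mem_union.1 ha with ha | ha
        · exact hC (Finset.add_mem_add ha hb)
        · obtain ⟨y, hy, rfl⟩ := Finset.mem_image.1 ha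
          rw [add_right_comm]
          exact hC (Finset.add_mem_add hb' (Finset.mem_filter.1 hy).1))
    exact ⟨A', B', h0, hA', hcl, by omega⟩

/-- Kneser's theorem for the sum of a finite set with itself. -/
theorem isPeriodicOfSize_add_self [Finite G] [DecidableEq G] {T : Finset G} (hT : T.Nonempty) :
    IsPeriodicOfSize (2 * T.card) (T + T) := by
  -- Every point of `T + T` lies in a periodic piece of sufficient size, the closure of two
  -- translates of `T`; `T + T` is the union of these pieces.
  have hpt : ∀ c ∈ T + T, ∃ D : Finset G, c ∈ D ∧ D ⊆ T + T ∧ IsPeriodicOfSize (2 * T.card) D := by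
    intro c hc
    obtain ⟨a, ha, b, hb, rfl⟩ := Finset.mem_add.1 hc
    obtain ⟨A', B', h0, hA', hcl, hle⟩ := exists_dyson_closure_finset _ (A := T.image (· - a))
      (B := T.image (· - b)) (C := (T + T).image (· - (a + b))) rfl
      (Finset.mem_image.2 ⟨a, ha, sub_self a⟩) (Finset.mem_image.2 ⟨b, hb, sub_self b⟩) (by
        intro x hx
        obtain ⟨y, hy, z, hz, rfl⟩ := Finset.mem_add.1 hx
        obtain ⟨y', hy', rfl⟩ := Finset.mem_image.1 hy
        obtain ⟨z', hz', rfl⟩ := Finset.mem_image.1 hz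
        exact Finset.mem_image.2 ⟨y' + z', Finset.add_mem_add hy' hz', by abel⟩)
    rw [Finset.card_image_of_injective _ sub_left_injective,
      Finset.card_image_of_injective _ sub_left_injective] at hle
    refine ⟨A'.image (· + (a + b)), Finset.mem_image.2 ⟨0, h0, zero_add _⟩, ?_, periods A', ?_, ?_⟩
    · intro x hx
      obtain ⟨y, hy, rfl⟩ := Finset.mem_image.1 hx
      obtain ⟨z, hz, rfl⟩ := Finset.mem_image.1 (hA' hy)
      simpa using hz
    · intro x hx h hh
      obtain ⟨y, hy, rfl⟩ := Finset.mem_image.1 hx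
      refine Finset.mem_image.2 ⟨y + h, (hh y).1 hy, by abel⟩
    · rw [Finset.card_image_of_injective _ (add_left_injective _)]
      have h1 : B'.card ≤ Nat.card (periods A') := by
        have hfin : ((periods A' : AddSubgroup G) : Set G).Finite := Set.toFinite _
        have hcard : Nat.card (periods A') = hfin.toFinset.card :=
          Nat.card_eq_card_finite_toFinset hfin
        rw [hcard]
        exact Finset.card_le_card fun b hb => hfin.mem_toFinset.2
          (mem_periods_of_forall_mem fun x hx => hcl x hx b hb)
      omega
  have hall : ∀ s : Finset G, s.Nonempty → s ⊆ T + T →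
      ∃ D : Finset G, s ⊆ D ∧ D ⊆ T + T ∧ IsPeriodicOfSize (2 * T.card) D := by
    intro s hs
    induction hs using Finset.Nonempty.cons_induction with
    | singleton c =>
      intro hc
      obtain ⟨D, h1, h2⟩ := hpt c (Finset.singleton_subset_iff.1 hc)
      exact ⟨D, Finset.singleton_subset_iff.2 h1, h2⟩
    | cons c s hcs hs ih =>
      intro hsub
      rw [Finset.cons_eq_insert, Finset.insert_subset_iff] at hsub
      obtain ⟨D, h1, h2, h3⟩ := hpt c hsub.1
      obtain ⟨D', h1', h2', h3'⟩ := ih hsub.2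
      refine ⟨D ∪ D', ?_, Finset.union_subset h2 h2', h3.union h3'⟩
      rw [Finset.cons_eq_insert, Finset.insert_subset_iff]
      exact ⟨Finset.mem_union_left _ h1, h1'.trans Finset.subset_union_right⟩
  obtain ⟨D, h1, h2, h3⟩ := hall (T + T) (hT.add hT) subset_rfl
  rwa [Finset.Subset.antisymm h2 h1] at h3

/-- A set with `|2S| < 2|S|` in a finite group has, modulo the subgroup of periods of `2S`, exactly
`r` elements where `2S` has exactly `2r - 1`. -/
theorem exists_card_add_self_eq [Finite G] [DecidableEq G] {S : Finset G}
    (h : (S + S).card < 2 * S.card) :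
    ∃ g h r : ℕ, 0 < r ∧ g * h = Nat.card G ∧ (S + S).card + h = 2 * r * h ∧ S.card ≤ r * h ∧
      2 * r ≤ g + 1 := by
  classical
  have := Fintype.ofFinite G
  have hS : S.Nonempty := by
    rw [← Finset.card_pos]; omega
  set H := periods (S + S) with hH
  have hper : ∀ x ∈ S + S, ∀ h ∈ H, x + h ∈ S + S := fun x hx h hh => (hh x).1 hx
  -- Filling `S` up to full cosets of `H` leaves `2S` unchanged and makes all sizes multiples of
  -- `|H|`.
  set S₁ : Finset G := S + ({x | x ∈ H} : Finset G) with hS₁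
  have hSS₁ : S ⊆ S₁ := fun x hx => by
    simpa using Finset.add_mem_add hx (show (0 : G) ∈ ({x | x ∈ H} : Finset G) by simp)
  have hS₁S₁ : S₁ + S₁ = S + S := by
    refine Finset.Subset.antisymm (fun x hx => ?_) (Finset.add_subset_add hSS₁ hSS₁)
    obtain ⟨y, hy, z, hz, rfl⟩ := Finset.mem_add.1 hx
    obtain ⟨y', hy', k, hk, rfl⟩ := Finset.mem_add.1 hy
    obtain ⟨z', hz', l, hl, rfl⟩ := Finset.mem_add.1 hz
    rw [add_add_add_comm]
    exact hper _ (Finset.add_mem_add hy' hz') _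
      (H.add_mem (by simpa using hk) (by simpa using hl))
  obtain ⟨K, hK, hle⟩ := isPeriodicOfSize_add_self (hS.mono hSS₁)
  rw [hS₁S₁] at hK hle
  have hKH : K ≤ H := fun k hk => mem_periods_of_forall_mem fun x hx => hK x hx k hk
  have hKH' : Nat.card K ≤ Nat.card H := AddSubgroup.card_le_of_le hKH
  obtain ⟨N, hN⟩ := card_dvd_card_of_periodic hper
  obtain ⟨r, hr⟩ : Nat.card H ∣ S₁.card := card_dvd_card_of_periodic fun x hx k hk => by
    obtain ⟨y, hy, l, hl, rfl⟩ := Finset.mem_add.1 hx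
    rw [add_assoc]
    exact Finset.add_mem_add hy (by simpa using H.add_mem (by simpa using hl) hk)
  obtain ⟨g, hg⟩ := H.card_addSubgroup_dvd_card
  have hle₁ := Finset.card_le_card hSS₁
  have hH0 : 0 < Nat.card H := Nat.card_pos
  have hS0 := hS.card_pos
  have hNg : N ≤ g := by
    refine Nat.le_of_mul_le_mul_left (c := Nat.card H) ?_ hH0 
    rw [← hN, ← hg, Nat.card_eq_fintype_card]
    exact Finset.card_le_univ _
  -- Kneser's bound for `S₁` gives `2r ≤ N + 1`, while `|2S| < 2|S| ≤ 2|S₁|` gives `N < 2r`.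
  have h1 : 2 * r ≤ N + 1 := by
    refine Nat.le_of_mul_le_mul_left (c := Nat.card H) ?_ hH0
    nlinarith
  have h2 : N < 2 * r := by
    refine Nat.lt_of_mul_lt_mul_left (a := Nat.card H) ?_
    nlinarith
  have h3 : N + 1 = 2 * r := by omega
  refine ⟨g, Nat.card H, r, by omega, by rw [hg, mul_comm], ?_, by rw [mul_comm, ← hr]; exact hle₁,
    by omega⟩
  rw [← h3, hN]; ring

end Kneser

/-! ### The structure theorem for the densities. -/

theorem exists_structure_of_lt {A : Set ℕ} {α β : ℝ} (hA : HasDensity A α)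
    (hC : HasDensity (A + A) β) (h : β < 2 * α) :
    ∃ g r : ℕ, 0 < g ∧ 0 < r ∧ (r : ℝ) ≤ ((g : ℝ) + 1) / 2 ∧
      β = (2 * (r : ℝ) - 1) / (g : ℝ) ∧ β / 2 < α ∧ α ≤ β / 2 + 1 / (2 * (g : ℝ)) := by
  obtain ⟨L, hL, S, hα, hβ⟩ := exists_residues hA hC h
  have hLr : (0 : ℝ) < L := by exact_mod_cast hL.pos
  have hlt : (S + S).card < 2 * S.card := by
    have h1 : ((S + S).card : ℝ) / L < 2 * (S.card / L) := by rw [← hβ]; linarith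
    rw [← mul_div_assoc, div_lt_div_iff_of_pos_right hLr] at h1
    exact_mod_cast h1
  obtain ⟨g, k, r, hr, hgk, hSS, hS, hrg⟩ := exists_card_add_self_eq hlt
  rw [Nat.card_zmod] at hgk
  have hL0 : 0 < g * k := hgk ▸ hL.pos
  have hg : 0 < g := Nat.pos_of_mul_pos_right hL0
  have hk : 0 < k := Nat.pos_of_mul_pos_left hL0
  have hgr : (0 : ℝ) < g := by exact_mod_cast hg
  have hkr : (0 : ℝ) < k := by exact_mod_cast hk
  have hLgk : (L : ℝ) = g * k := by exact_mod_cast hgk.symm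
  have hβ' : β = (2 * (r : ℝ) - 1) / g := by
    have : ((S + S).card : ℝ) + k = 2 * r * k := by exact_mod_cast hSS
    rw [hβ, hLgk, div_eq_div_iff (by positivity) hgr.ne']
    linear_combination (g : ℝ) * this
  refine ⟨g, r, hg, hr, ?_, hβ', by linarith, ?_⟩
  · have : (2 * r : ℝ) ≤ g + 1 := by exact_mod_cast hrg
    linarith
  · have h1 : (S.card : ℝ) ≤ r * k := by exact_mod_cast hS
    have h2 : α ≤ r / g := by
      refine hα.trans ?_
      rw [hLgk, div_le_div_iff₀ (by positivity) hgr]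
      nlinarith
    refine h2.trans (le_of_eq ?_)
    rw [hβ']
    field_simp
    ring

/-! ### Sets with prescribed densities. -/

lemma hasDensity_of_abs_le {S : Set ℕ} {d K : ℝ}
    (h : ∀ N : ℕ, |((below S N).card : ℝ) - d * N| ≤ K) : HasDensity S d := by
  rw [hasDensity_iff]
  intro ε hε
  obtain ⟨N₀, hN₀⟩ := exists_nat_gt (K / ε)
  refine ⟨N₀, fun N hN => (h N).trans ?_⟩
  have : K / ε ≤ N := hN₀.le.trans (by exact_mod_cast hN)
  rwa [div_le_iff₀' hε] at this

lemma HasDensity.of_eventually_iff {S S' : Set ℕ} {d : ℝ} (hS : HasDensity S d) {n₀ : ℕ}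
    (h : ∀ n ≥ n₀, n ∈ S ↔ n ∈ S') : HasDensity S' d := by
  classical
  have key : ∀ {U V : Set ℕ}, (∀ n ≥ n₀, n ∈ U → n ∈ V) → ∀ N,
      ((below U N).card : ℝ) ≤ (below V N).card + n₀ := by
    intro U V hUV N
    have hsub : below U N ⊆ below V N ∪ Finset.range n₀ := by
      intro n hn
      rw [mem_below] at hn
      rcases lt_or_ge n n₀ with hlt | hge
      · exact Finset.mem_union_right _ (Finset.mem_range.2 hlt)
      · exact Finset.mem_union_left _ (mem_below.2 ⟨hn.1, hUV n hge hn.2⟩)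
    have := (Finset.card_le_card hsub).trans (Finset.card_union_le _ _)
    rw [Finset.card_range] at this
    exact_mod_cast this
  rw [hasDensity_iff] at hS ⊢
  intro ε hε
  obtain ⟨N₁, hN₁⟩ := hS (ε / 2) (by positivity)
  obtain ⟨N₂, hN₂⟩ := exists_nat_gt ((n₀ : ℝ) / (ε / 2))
  refine ⟨max N₁ N₂, fun N hN => ?_⟩
  simp only [ge_iff_le, max_le_iff] at hN
  have h1 := hN₁ N hN.1
  have h2 : (n₀ : ℝ) / (ε / 2) ≤ N := hN₂.le.trans (by exact_mod_cast hN.2)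
  rw [div_le_iff₀' (by positivity)] at h2
  have h3 := key (fun n hn => (h n hn).1) N
  have h4 := key (fun n hn => (h n hn).2) N
  rw [abs_le] at *
  constructor <;> linarith

/-- The `j` at which `⌊j θ⌋` increases. -/
def jumpSet (θ : ℝ) : Set ℕ := {j | ⌊(j : ℝ) * θ⌋₊ < ⌊((j + 1 : ℕ) : ℝ) * θ⌋₊}

lemma floor_succ_mul {θ : ℝ} (h0 : 0 ≤ θ) (h1 : θ ≤ 1) (j : ℕ) [Decidable (j ∈ jumpSet θ)] :
    ⌊((j + 1 : ℕ) : ℝ) * θ⌋₊ = ⌊(j : ℝ) * θ⌋₊ + if j ∈ jumpSet θ then 1 else 0 := by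
  have hle : ⌊((j + 1 : ℕ) : ℝ) * θ⌋₊ ≤ ⌊(j : ℝ) * θ⌋₊ + 1 := by
    rw [← Nat.floor_add_one (by positivity)]
    refine Nat.floor_le_floor ?_
    push_cast
    linarith
  have hge : ⌊(j : ℝ) * θ⌋₊ ≤ ⌊((j + 1 : ℕ) : ℝ) * θ⌋₊ := by
    refine Nat.floor_le_floor ?_
    push_cast
    linarith
  by_cases h : j ∈ jumpSet θ
  · have : ⌊(j : ℝ) * θ⌋₊ < ⌊((j + 1 : ℕ) : ℝ) * θ⌋₊ := h
    rw [if_pos h]; omega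
  · have : ¬ ⌊(j : ℝ) * θ⌋₊ < ⌊((j + 1 : ℕ) : ℝ) * θ⌋₊ := h
    rw [if_neg h]; omega

lemma card_below_jumpSet {θ : ℝ} (h0 : 0 ≤ θ) (h1 : θ ≤ 1) (J : ℕ) :
    (below (jumpSet θ) J).card = ⌊(J : ℝ) * θ⌋₊ := by
  classical
  have hcount : ∀ J, (below (jumpSet θ) J).card = Nat.count (· ∈ jumpSet θ) J := fun J => by
    rw [Nat.count_eq_card_filter_range]
    congr 1
  rw [hcount]
  induction J with
  | zero => simp
  | succ J ih => rw [Nat.count_succ, ih, floor_succ_mul h0 h1]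

/-- The union of the first `s` residue classes modulo `q` and of the proportion `θ` of the next
one. -/
def initialResidues (q s : ℕ) (θ : ℝ) : Set ℕ :=
  {n | n % q < s ∨ (n % q = s ∧ n / q ∈ jumpSet θ)}

lemma card_below_initialResidues {q s : ℕ} {θ : ℝ} (hs : s < q) (h0 : 0 ≤ θ) (h1 : θ ≤ 1) (J : ℕ) :
    (below (initialResidues q s θ) (q * J)).card = s * J + ⌊(J : ℝ) * θ⌋₊ := by
  classical
  have hcount : ∀ N, (below (initialResidues q s θ) N).card =
      Nat.count (· ∈ initialResidues q s θ) N := fun N => by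
    rw [Nat.count_eq_card_filter_range]
    congr 1
  rw [hcount]
  induction J with
  | zero => simp
  | succ J ih =>
    rw [Nat.mul_succ, Nat.count_add, ih, floor_succ_mul h0 h1]
    have hblock : Nat.count (fun i => q * J + i ∈ initialResidues q s θ) q =
        s + if J ∈ jumpSet θ then 1 else 0 := by
      have hq : 0 < q := by omega
      have hmem : ∀ i < q, (q * J + i ∈ initialResidues q s θ ↔ i < s ∨ i = s ∧ J ∈ jumpSet θ) := by
        intro i hi
        simp only [initialResidues, Set.mem_ofPred_eq, Nat.mul_add_mod, Nat.mod_eq_of_lt hi]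
        rw [Nat.mul_add_div hq, Nat.div_eq_of_lt hi, add_zero]
      rw [Nat.count_eq_card_filter_range]
      by_cases hJ : J ∈ jumpSet θ
      · rw [if_pos hJ, ← Finset.card_range (s + 1)]
        congr 1
        ext i
        simp only [Finset.mem_filter, Finset.mem_range]
        constructor
        · rintro ⟨hi, h⟩
          have := (hmem i hi).1 h
          omega
        · intro hi
          refine ⟨by omega, (hmem i (by omega)).2 ?_⟩
          by_cases h : i < s
          · exact Or.inl h
          · exact Or.inr ⟨by omega, hJ⟩
      · rw [if_neg hJ, add_zero]
        conv_rhs => rw [← Finset.card_range s]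
        congr 1
        ext i
        simp only [Finset.mem_filter, Finset.mem_range]
        constructor
        · rintro ⟨hi, h⟩
          rcases (hmem i hi).1 h with h | h
          · exact h
          · exact absurd h.2 hJ
        · intro hi
          exact ⟨by omega, (hmem i (by omega)).2 (Or.inl hi)⟩
    rw [hblock]
    ring

lemma hasDensity_initialResidues {q s : ℕ} {θ : ℝ} (hs : s < q) (h0 : 0 ≤ θ) (h1 : θ ≤ 1) :
    HasDensity (initialResidues q s θ) ((s + θ) / q) := by
  have hq : 0 < q := by omega
  have hqr : (0 : ℝ) < q := by exact_mod_cast hq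
  refine hasDensity_of_abs_le (K := s + 2) fun N => ?_
  have hmono : ∀ {M N : ℕ}, M ≤ N →
      (below (initialResidues q s θ) M).card ≤ (below (initialResidues q s θ) N).card := by
    intro M N hMN
    refine Finset.card_le_card fun x hx => ?_
    rw [mem_below] at hx ⊢
    exact ⟨by omega, hx.2⟩
  have hN1 : q * (N / q) ≤ N := Nat.mul_div_le N q
  have hN2 : N ≤ q * (N / q + 1) := (Nat.lt_mul_div_succ N hq).le
  have i1 := hmono hN1
  have i2 := hmono hN2
  rw [card_below_initialResidues hs h0 h1] at i1 i2
  set J := N / q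
  have k1 : (q : ℝ) * J ≤ N := by exact_mod_cast hN1
  have k2 : (N : ℝ) ≤ q * (J + 1) := by exact_mod_cast hN2
  have j1 : (s : ℝ) * J + ⌊(J : ℝ) * θ⌋₊ ≤ (below (initialResidues q s θ) N).card := by
    exact_mod_cast i1
  have j2 : ((below (initialResidues q s θ) N).card : ℝ) ≤
      s * (J + 1) + ⌊((J + 1 : ℕ) : ℝ) * θ⌋₊ := by exact_mod_cast i2
  have f1 := Nat.lt_floor_add_one ((J : ℝ) * θ)
  have f2 : ((⌊((J + 1 : ℕ) : ℝ) * θ⌋₊ : ℕ) : ℝ) ≤ ((J : ℝ) + 1) * θ :=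
    (Nat.floor_le (by positivity)).trans (le_of_eq (by push_cast; rfl))
  have e1 : (s + θ) / q * N ≤ (s + θ) * (J + 1) := by
    rw [div_mul_eq_mul_div, div_le_iff₀ hqr]
    nlinarith [mul_le_mul_of_nonneg_left k2 (by positivity : (0 : ℝ) ≤ s + θ)]
  have e2 : (s + θ) * J ≤ (s + θ) / q * N := by
    rw [div_mul_eq_mul_div, le_div_iff₀ hqr]
    nlinarith [mul_le_mul_of_nonneg_left k1 (by positivity : (0 : ℝ) ≤ s + θ)]
  rw [abs_le]
  constructor <;> nlinarith

/-- Pigeonhole: the positive jumps below `j` and their reflections under `x ↦ j - x` lie in `[1, j -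
1]`, and each set has at least `j / 2` elements. The constant 4 in `j₀` covers the floor and the
removal of 0. -/
lemma exists_add_eq_of_jumpSet {θ : ℝ} (h0 : 1 / 2 < θ) (h1 : θ ≤ 1) :
    ∃ j₀ : ℕ, ∀ j ≥ j₀, ∃ u v : ℕ, 0 < u ∧ 0 < v ∧ u ∈ jumpSet θ ∧ v ∈ jumpSet θ ∧ u + v = j := by
  classical
  obtain ⟨j₀, hj₀⟩ := exists_nat_gt (4 / (2 * θ - 1))
  refine ⟨j₀ + 1, fun j hj => ?_⟩
  have hθ : 0 < 2 * θ - 1 := by linarith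
  have hj1 : (4 / (2 * θ - 1) : ℝ) < j :=
    hj₀.trans (by exact_mod_cast (by omega : j₀ < j))
  rw [div_lt_iff₀ hθ] at hj1
  set X : Finset ℕ := (below (jumpSet θ) j).erase 0 with hX
  have hXcard : j ≤ 2 * X.card := by
    have e1 : (below (jumpSet θ) j).card ≤ X.card + 1 := by
      have := Finset.pred_card_le_card_erase (s := below (jumpSet θ) j) (a := 0)
      rw [← hX] at this
      omega
    rw [card_below_jumpSet (by linarith) h1] at e1
    have f1 := Nat.lt_floor_add_one ((j : ℝ) * θ)
    have e2 : ((⌊(j : ℝ) * θ⌋₊ : ℕ) : ℝ) ≤ X.card + 1 := by exact_mod_cast e1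
    have : (j : ℝ) ≤ 2 * X.card := by nlinarith
    exact_mod_cast this
  have hXmem : ∀ x ∈ X, 0 < x ∧ x < j ∧ x ∈ jumpSet θ := by
    intro x hx
    obtain ⟨hx0, hx⟩ := Finset.mem_erase.1 hx
    rw [mem_below] at hx
    exact ⟨Nat.pos_of_ne_zero hx0, hx⟩
  have hinj : Set.InjOn (fun x => j - x) (X : Set ℕ) := by
    intro x hx y hy hxy
    have h1 := hXmem x hx
    have h2 := hXmem y hy
    simp only at hxy
    omega
  by_cases hd : Disjoint X (X.image (fun x => j - x))
  · have hsub : X ∪ X.image (fun x => j - x) ⊆ Finset.Ico 1 j := by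
      intro x hx
      rw [Finset.mem_Ico]
      rcases Finset.mem_union.1 hx with hx | hx
      · have := hXmem x hx; omega
      · obtain ⟨y, hy, rfl⟩ := Finset.mem_image.1 hx
        have := hXmem y hy; omega
    have := Finset.card_le_card hsub
    rw [Finset.card_union_of_disjoint hd, Finset.card_image_of_injOn hinj, Nat.card_Ico] at this
    omega
  · obtain ⟨x, hx, hx'⟩ := Finset.not_disjoint_iff.1 hd
    obtain ⟨y, hy, rfl⟩ := Finset.mem_image.1 hx'
    have a1 := hXmem _ hx
    have a2 := hXmem y hy
    exact ⟨j - y, y, a1.1, a2.1, a1.2.2, a2.2.2, by omega⟩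

theorem exists_set_of_densities {q r : ℕ} (hr : 0 < r) (hrq : 2 * r ≤ q) {α : ℝ}
    (hα : (2 * (r : ℝ) - 1) / q / 2 < α) (hα' : α ≤ r / q) :
    ∃ A : Set ℕ, (∀ a ∈ A, 1 ≤ a) ∧ HasDensity A α ∧
      HasDensity (A + A) ((2 * (r : ℝ) - 1) / q) := by
  have hq : 0 < q := by omega
  have hqr : (0 : ℝ) < q := by exact_mod_cast hq
  obtain ⟨s, rfl⟩ : ∃ s, r = s + 1 := ⟨r - 1, by omega⟩
  push_cast at *
  set θ : ℝ := q * α - s with hθ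
  have hθ1 : θ ≤ 1 := by
    rw [le_div_iff₀ hqr] at hα'
    rw [hθ]; linarith
  have hθ0 : 1 / 2 < θ := by
    rw [div_div, div_lt_iff₀ (by positivity)] at hα
    rw [hθ]; linarith
  have hαθ : α = (s + θ) / q := by
    rw [hθ]; field_simp; ring
  set A : Set ℕ := {n | 1 ≤ n ∧ n ∈ initialResidues q s θ} with hA
  have hblock : ∀ i j, i < s → 0 < j → q * j + i ∈ A := by
    intro i j hi hj
    refine ⟨?_, Or.inl ?_⟩
    · have : 0 < q * j := by positivity
      omega
    · rwa [Nat.mul_add_mod, Nat.mod_eq_of_lt (by omega)]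
  have hlast : ∀ j, 0 < j → j ∈ jumpSet θ → q * j + s ∈ A := by
    intro j hj hjθ
    refine ⟨?_, Or.inr ⟨?_, ?_⟩⟩
    · have : 0 < q * j := by positivity
      omega
    · rw [Nat.mul_add_mod, Nat.mod_eq_of_lt (by omega)]
    · rwa [Nat.mul_add_div hq, Nat.div_eq_of_lt (by omega), add_zero]
  refine ⟨A, fun a ha => ha.1, ?_, ?_⟩
  · rw [hαθ]
    exact (hasDensity_initialResidues (by omega) (by linarith) hθ1).of_eventually_iff (n₀ := 1)
      fun n hn => ⟨fun h => ⟨hn, h⟩, fun h => h.2⟩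
  -- As `2s + 1 < q`, sums of residues at most `s` do not wrap around. Residues below `s` come from
  -- two full classes, those from `s` to `2s - 1` from a full class and the partial one, and `2s`
  -- from the partial class twice, where `θ > 1/2` is needed.
  · obtain ⟨j₀, hj₀⟩ := exists_add_eq_of_jumpSet hθ0 hθ1
    have hres := hasDensity_initialResidues (q := q) (s := 2 * s + 1) (θ := 0) (by omega) le_rfl
      zero_le_one
    have hd : (2 * ((s : ℝ) + 1) - 1) / q = (((2 * s + 1 : ℕ) : ℝ) + 0) / q := by
      push_cast; ring
    rw [hd]
    have hnojump : ∀ j, j ∉ jumpSet 0 := fun j => by simp [jumpSet]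
    refine hres.of_eventually_iff (n₀ := q * (j₀ + 2)) fun n hn => ⟨fun h => ?_, fun h => ?_⟩
    · have hn' : n % q ≤ 2 * s := by
        rcases h with h | h
        · omega
        · exact absurd h.2 (hnojump _)
      have hj : j₀ + 2 ≤ n / q := (Nat.le_div_iff_mul_le hq).2 (by rw [mul_comm]; exact hn)
      have hndiv := Nat.div_add_mod n q
      set j := n / q
      set i := n % q
      obtain ⟨u, v, hu, hv, huθ, hvθ, huv⟩ := hj₀ j (by omega)
      have hqj : q * j = q * u + q * v := by rw [← huv]; ring
      rcases Nat.lt_or_ge (2 * s) (i + 1) with hi | hi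
      · exact ⟨_, hlast u hu huθ, _, hlast v hv hvθ, by simp only; omega⟩
      rcases Nat.lt_or_ge i s with his | his
      · exact ⟨_, hblock 0 u (by omega) hu, _, hblock i v his hv, by simp only; omega⟩
      · exact ⟨_, hlast u hu huθ, _, hblock (i - s) v (by omega) hv, by simp only; omega⟩
    · obtain ⟨a, ⟨-, ha⟩, b, ⟨-, hb⟩, rfl⟩ := h
      have hle : ∀ n ∈ initialResidues q s θ, n % q ≤ s := by
        rintro n (h | h) <;> omega
      have h1 := hle a ha
      have h2 := hle b hb
      refine Or.inl ?_
      simp only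
      rw [Nat.add_mod, Nat.mod_eq_of_lt (by omega)]
      omega

/-! ### The 2-adic condition and the conclusion. -/

lemma odd_num_of_padicValRat_nonpos {β : ℚ} (h0 : β ≠ 0) (h : padicValRat 2 β ≤ 0) : Odd β.num := by
  rw [← Int.not_even_iff_odd]
  intro heven
  have hdvd : (2 : ℤ) ∣ β.num := heven.two_dvd
  have hdvd' : 2 ∣ β.num.natAbs := Int.natCast_dvd.1 (by exact_mod_cast hdvd)
  have hden : ¬ 2 ∣ β.den := fun h2 => by
    have := Nat.dvd_gcd hdvd' h2
    rw [β.reduced.gcd_eq_one] at this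
    omega
  have h1 : padicValNat 2 β.den = 0 := padicValNat.eq_zero_of_not_dvd hden
  have h2 : 1 ≤ padicValNat 2 β.num.natAbs :=
    one_le_padicValNat_of_dvd (Int.natAbs_ne_zero.2 (Rat.num_ne_zero.2 h0)) hdvd'
  rw [padicValRat_def, h1, padicValInt] at h
  omega

/-- `g * β` is an integer only if the denominator divides `g`, and the denominator itself yields the
numerator, which is odd. -/
lemma isLeast_den {β : ℚ} (h : Odd β.num) :
    IsLeast {g : ℕ | 1 ≤ g ∧ ∃ k : ℤ, Odd k ∧ (g : ℚ) * β = (k : ℚ)} β.den := by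
  refine ⟨⟨β.den_pos, β.num, h, Rat.den_mul_eq_num β⟩, ?_⟩
  rintro g ⟨hg, k, -, hk⟩
  have h1 : (g : ℤ) * β.num = k * β.den := by
    have h2 : (g : ℚ) * β.num = k * β.den := by
      rw [← hk, ← Rat.den_mul_eq_num β]; ring
    exact_mod_cast h2
  have h3 : (β.den : ℤ) ∣ g := by
    refine IsCoprime.dvd_of_dvd_mul_right (z := β.num) ?_ ⟨k, by rw [h1, mul_comm]⟩
    exact Int.isCoprime_iff_gcd_eq_one.2 (by
      have := β.reduced
      rw [Nat.Coprime, Nat.gcd_comm] at this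
      simpa [Int.gcd] using this)
  exact Nat.le_of_dvd hg (by exact_mod_cast h3)

theorem theorem3 :
    -- structure of the sets `A` with `d(2A) < 2 d(A)`
    (∀ (A : Set ℕ) (α β : ℝ), HasDensity A α → HasDensity (A + A) β → β < 2 * α →
      ∃ g r : ℕ, 0 < g ∧ 0 < r ∧ (r : ℝ) ≤ ((g : ℝ) + 1) / 2 ∧
        β = (2 * (r : ℝ) - 1) / (g : ℝ) ∧
        β / 2 < α ∧ α ≤ β / 2 + 1 / (2 * (g : ℝ))) ∧
    -- the pairs `(d(A), d(2A)) = (α, β)` with `β < 2 α`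
    (∀ β : ℚ, 0 < β → β < 1 → padicValRat 2 β ≤ 0 →
      ∃ g₀ : ℕ, IsLeast {g : ℕ | 1 ≤ g ∧ ∃ k : ℤ, Odd k ∧ (g : ℚ) * β = (k : ℚ)} g₀ ∧
        ∀ α : ℝ, 0 < α → α < 1 → (β : ℝ) < 2 * α →
          ((∃ A : Set ℕ, (∀ a ∈ A, 1 ≤ a) ∧ HasDensity A α ∧ HasDensity (A + A) (β : ℝ)) ↔
            ((β : ℝ) / 2 < α ∧ α ≤ (β : ℝ) / 2 + 1 / (2 * (g₀ : ℝ))))) := by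
  refine ⟨fun A α β hA hC h => exists_structure_of_lt hA hC h, fun β hβ0 hβ1 hβ2 => ?_⟩
  have hodd := odd_num_of_padicValRat_nonpos hβ0.ne' hβ2
  have hleast := isLeast_den hodd
  refine ⟨β.den, hleast, fun α hα0 hα1 hlt => ⟨?_, ?_⟩⟩
  · rintro ⟨A, -, hA, hC⟩
    obtain ⟨g, r, hg, hr, -, hβ, h1, h2⟩ := exists_structure_of_lt hA hC hlt
    refine ⟨h1, h2.trans ?_⟩
    have hgr : (0 : ℝ) < g := by exact_mod_cast hg
    have hmem : β.den ≤ g := by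
      refine hleast.2 ⟨hg, 2 * (r : ℤ) - 1, ⟨r - 1, by ring⟩, ?_⟩
      rw [eq_div_iff hgr.ne'] at hβ
      have : (((g : ℚ) * β : ℚ) : ℝ) = ((2 * r - 1 : ℚ) : ℝ) := by
        push_cast; linarith
      push_cast
      exact_mod_cast this
    have hden : (0 : ℝ) < β.den := by exact_mod_cast β.den_pos
    have : (β.den : ℝ) ≤ g := by exact_mod_cast hmem
    gcongr
  · rintro ⟨h1, h2⟩
    obtain ⟨k, hk⟩ := hodd
    have hnum : 0 < β.num := Rat.num_pos.2 hβ0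
    -- With `β.num = 2r - 1`, this yields `2r ≤ β.den`, as the construction requires.
    have hnumlt : β.num < β.den := Rat.num_lt_denom_iff.2 hβ1
    obtain ⟨r, hr⟩ : ∃ r : ℕ, (r : ℤ) = k + 1 := ⟨(k + 1).toNat, Int.toNat_of_nonneg (by omega)⟩
    have hden : (0 : ℝ) < β.den := by exact_mod_cast β.den_pos
    have hβ : (β : ℝ) = (2 * (r : ℝ) - 1) / β.den := by
      have e1 : (β.num : ℝ) = 2 * (r : ℝ) - 1 := by
        have : β.num = 2 * (r : ℤ) - 1 := by omega
        exact_mod_cast this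
      rw [← e1]
      exact Rat.cast_def β
    rw [hβ] at h1 h2 ⊢
    refine exists_set_of_densities (by omega) (by omega) h1 (h2.trans (le_of_eq ?_))
    field_simp
    ring
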